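/- Let $\mathbb{D}=\{|z|<1\}$, $\mathbb{T}=\{|z|=1\}$, let $m$ be arclength measure on $\mathbb{T}$ normalized by $m(\mathbb{T})=1$, and let $dA=\pi^{-1}\,dx\,dy$ on $\mathbb{D}$. Let $G\colon(0,1]\to[0,\infty)$ be a Borel measurable function such that $\int_{\mathbb{D}}G(1-|z|)\,dA(z)<\infty$ (for instance, any increasing function) and $$\liminf_{x\to0^+}\,x\log\bigl(1/G(x)\bigr)>0 ,$$ where $\log(1/0)=+\infty$. Let $w\in L^1(m)$ be a non-negative Borel measurable function on $\mathbb{T}$, let $E=\{x\in\mathbb{T}: w(x)>0\}$ be its carrier set, and let $$F=\Bigl\{x\in E:\ \int_I\log w\,dm=-\infty\ \text{ for every open arc } I\subseteq\mathbb{T}\text{ with }x\in I\Bigr\}$$ be its residual set (with $\log 0=-\infty$). Let $\mu$ be the finite Borel measure on $\overline{\mathbb{D}}$ given by $d\mu=G(1-|z|)\,dA+w\,dm$, let $\mu_F$ be the restriction of $\mu$ to $F$, and for $0<t<\infty$ let $\mathcal{P}^t(\mu)$ be the closure of the set of analytic polynomials in $L^t(\mu)$. Assume that $m(F)>0$. Then,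 for every finite $t>0$, $$L^t(\mu_F)\subset\mathcal{P}^t(\mu),$$ where $L^t(\mu_F)$ is regarded as a subspace of $L^t(\mu)$ through extension by zero. -/

import Mathlib

open MeasureTheory Filter Set Topology
open scoped ENNReal Polynomial

namespace RadialSplitting

noncomputable section

instance instMeasurableSpaceCircle : MeasurableSpace Circle :=
  inferInstanceAs (MeasurableSpace (Submonoid.unitSphere ℂ))

instance instBorelSpaceCircle : BorelSpace Circle :=
  inferInstanceAs (BorelSpace (Submonoid.unitSphere ℂ))

/-- The arclength measure `m` on the unit circle, normalized to total mass `1`. -/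
def circleMeasure : Measure Circle :=
  (ENNReal.ofReal (2 * Real.pi))⁻¹ •
    Measure.map Circle.exp (volume.restrict (Ioc (-Real.pi) Real.pi))

/-- The area measure `dA = π⁻¹ dx dy` on the open unit disk, as a measure on `ℂ`. -/
def diskMeasure : Measure ℂ :=
  (ENNReal.ofReal Real.pi)⁻¹ • volume.restrict (Metric.ball (0 : ℂ) 1)

/-- The part `G(1 - |z|) dA(z)` living on the open unit disk. -/
def muDisk (G : ℝ → ℝ) : Measure ℂ :=
  diskMeasure.withDensity fun z => ENNReal.ofReal (G (1 - ‖z‖))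

/-- The part `w dm` living on the unit circle, as a measure on `ℂ`. -/
def muCircle (w : Circle → ℝ) : Measure ℂ :=
  Measure.map (fun x : Circle => (x : ℂ))
    (circleMeasure.withDensity fun x => ENNReal.ofReal (w x))

/-- The measure `dμ = G(1 - |z|) dA + w dm`. -/
def mu (G : ℝ → ℝ) (w : Circle → ℝ) : Measure ℂ :=
  muDisk G + muCircle w

/-- At least exponential decay: `liminf_{x → 0+} x log (1 / G x) > 0`.
The logarithm takes values in `[-∞, ∞]`, with `log (1 / 0) = ∞`. -/
def ExpDec (G : ℝ → ℝ) : Prop :=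
  0 < liminf (fun x : ℝ => (x : EReal) * ENNReal.log (1 / ENNReal.ofReal (G x))) (𝓝[>] 0)

/-- Open arcs (intervals) of the unit circle. -/
def IsOpenArc (I : Set Circle) : Prop :=
  ∃ a b : ℝ, a < b ∧ b ≤ a + 2 * Real.pi ∧ I = Circle.exp '' Ioo a b

/-- The extended integral `∫_I log w dm`, with `log 0 = -∞`: the integral of the positive part
minus the integral of the negative part (the former is finite for integrable `w`). -/
def logIntegral (w : Circle → ℝ) (I : Set Circle) : EReal :=
  ((∫⁻ x in I, (ENNReal.log (ENNReal.ofReal (w x))).toENNReal ∂circleMeasure : ℝ≥0∞) : EReal) -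
    ((∫⁻ x in I, (-ENNReal.log (ENNReal.ofReal (w x))).toENNReal ∂circleMeasure : ℝ≥0∞) : EReal)

/-- The carrier set `E` of the weight `w`. -/
def carrierSet (w : Circle → ℝ) : Set Circle := {x | 0 < w x}

/-- The residual set `F` of the weight `w`. -/
def residualSet (w : Circle → ℝ) : Set Circle :=
  {x | x ∈ carrierSet w ∧ ∀ I : Set Circle, IsOpenArc I → x ∈ I → logIntegral w I = ⊥}

/-- `P^t(μ)`: the closure of the analytic polynomials in `L^t(μ)`. It is written with `eLpNorm`
because for `t < 1` the space `L^t(μ)` is not normed; convergence in the metric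
`∫ |f - g|^t dμ` is the same as convergence of `eLpNorm (f - g) t μ` to zero. -/
def polyClosure (t : ℝ≥0∞) (μ : Measure ℂ) : Set (Lp ℂ t μ) :=
  {f | ∀ ε : ℝ≥0∞, 0 < ε → ∃ p : ℂ[X], eLpNorm (fun z => f z - p.eval z) t μ < ε}

/-- `L^t(μ_F)`, where `μ_F` is the restriction of `μ` to `F`, regarded as a subset of `L^t(μ)`
through extension by zero. -/
def LpRestrict (t : ℝ≥0∞) (μ : Measure ℂ) (F : Set ℂ) : Set (Lp ℂ t μ) :=
  {f | ∃ g : Lp ℂ t (μ.restrict F), f =ᵐ[μ] F.indicator g}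

end

end RadialSplitting

/-!
The theorem is proved by an explicit construction of polynomials.

Cut the circle into short arcs of length at most `δ`. On an arc `I` which meets the residual set `F`
the integral of `log w` is `-∞`, so there is room for a bounded function `p ≥ 0` on the part of `I`
where `w` is tiny, with `exp (s p)` at most about `w ^ (-1/2)` there, and with `∫_I p = A m(F ∩ I)`
(`exists_bump`).
The density `ψ = p - A 1_F` has mean zero on each such arc (`exists_balanced`). Let `H` be the
Herglotz integral of `ψ` and `g = exp H`. Then

* `|g| = exp (-A)` on most of `F`, while elsewhere on the circle `|g|^s w ≤ w + √w`;
* because of the cancellation on short arcs, `H` is small on compact subsets of the disk and at the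
  points of the circle away from `F` (`Balanced.norm_cauchyInt_le`,
  `Balanced.norm_cauchyInt_le_of_far`), and `Re H ≤ C A δ / (1 - |z|)` in the whole disk
  (`Balanced.re_mul_cauchyInt_le`). With `A δ` small this growth is absorbed by the decay of `G`.

Hence, as `A → ∞` and `A δ → 0`, the functions `1 - g` tend to `1` on `F` and to `0` in the disk and
on the rest of the carrier of `w`, in which `F` is relatively closed (`exists_dist_residualSet`).
Since `H(0) = ∫ ψ = 0`, the quotient `(1 - g) / z` is holomorphic, and it tends to `z̄` on `F` and to
`0` elsewhere. Boundary values are avoided by replacing `g(z)` with `g(r z)`, where `r < 1` is so close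
to `1` that `exp (s Re H(r x))` is within a summable error of `exp (s ψ(x))` in `L¹(w dm)`
(`exists_radial_exp_approx`). Taylor polynomials of the quotients give the sequence of
`exists_polynomial_seq`, whose maximal function lies in `L^s(μ)`. Here `s` is arbitrary, so
dominated convergence applies to powers as well, and all `z^k 1_F` and `z̄^k 1_F` lie in `P^t(μ)`.
Trigonometric polynomials being dense in the continuous functions on the circle, and these in
`L^t(μ_F)`, the theorem follows.
-/

open MeasureTheory Filter Set Topology
open scoped ENNReal Polynomial

namespace RadialSplitting

/-! ### Poisson integrals on the circle and their radial limits -/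

instance : IsProbabilityMeasure circleMeasure := by
  constructor
  have h : Measurable (Circle.exp : ℝ → Circle) := Circle.exp.continuous.measurable
  rw [circleMeasure, Measure.smul_apply, Measure.map_apply h MeasurableSet.univ]
  simp only [preimage_univ, Measure.restrict_apply_univ, Real.volume_Ioc, smul_eq_mul]
  rw [show Real.pi - -Real.pi = 2 * Real.pi by ring]
  exact ENNReal.inv_mul_cancel (by simp [Real.pi_pos]) ENNReal.ofReal_ne_top

/-- Integrals against `circleMeasure`, taken over `(-π, π]`, are Mathlib's circle averages. -/
theorem integral_circleMeasure (f : ℂ → ℝ) (hf : Continuous fun x : Circle => f x) :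
    ∫ x : Circle, f x ∂circleMeasure = Real.circleAverage f 0 1 := by
  have h : Measurable (Circle.exp : ℝ → Circle) := Circle.exp.continuous.measurable
  rw [circleMeasure, integral_smul_measure, integral_map h.aemeasurable hf.aestronglyMeasurable]
  rw [← intervalIntegral.integral_of_le (by linarith [Real.pi_pos]), Real.circleAverage]
  rw [ENNReal.toReal_inv, ENNReal.toReal_ofReal (by positivity)]
  congr 1
  have hp : Function.Periodic (fun θ : ℝ => f (circleMap 0 1 θ)) (2 * Real.pi) := by
    intro θ
    simp only
    rw [periodic_circleMap 0 1 θ]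
  have := hp.intervalIntegral_add_eq (-Real.pi) 0
  rw [show -Real.pi + 2 * Real.pi = Real.pi by ring, zero_add] at this
  rw [← this]
  simp [circleMap, Circle.coe_exp]

theorem one_sub_norm_pos_and_le (x : Circle) {z : ℂ} (hz : ‖z‖ < 1) :
    0 < 1 - ‖z‖ ∧ 1 - ‖z‖ ≤ ‖(x : ℂ) - z‖ := by
  refine ⟨by linarith, ?_⟩
  have := norm_sub_norm_le (x : ℂ) z
  rw [Circle.norm_coe] at this
  exact this

/-- The Poisson kernel of the unit disk. -/
noncomputable def poissonK (z : ℂ) (x : Circle) : ℝ := (1 - ‖z‖ ^ 2) / ‖(x : ℂ) - z‖ ^ 2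

theorem continuous_poissonK {z : ℂ} (hz : ‖z‖ < 1) : Continuous (poissonK z) := by
  unfold poissonK
  refine Continuous.div (by fun_prop) (by fun_prop) fun x => ?_
  have := one_sub_norm_pos_and_le x hz
  have : 0 < ‖(x : ℂ) - z‖ := by linarith
  positivity

theorem poissonK_nonneg {z : ℂ} (hz : ‖z‖ < 1) (x : Circle) : 0 ≤ poissonK z x := by
  unfold poissonK
  have : 0 ≤ 1 - ‖z‖ ^ 2 := by nlinarith [norm_nonneg z]
  positivity

theorem integral_poissonK {z : ℂ} (hz : ‖z‖ < 1) : ∫ x, poissonK z x ∂circleMeasure = 1 := by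
  have h1 := DiffContOnCl.circleAverage_poissonKernel_smul (c := 0) (w := z) (R := 1)
    (f := fun _ => (1 : ℂ)) (by exact diffContOnCl_const) (by simpa using hz)
  have h2 : ∀ x : Circle, poissonK z x = poissonKernel 0 z x := by
    intro x
    simp [poissonKernel_def, poissonK, Circle.norm_coe]
  have h3 := integral_circleMeasure (poissonKernel 0 z) (by
    simpa only [← h2] using continuous_poissonK hz)
  simp only [h2, h3]
  have h4 : Real.circleAverage (poissonKernel 0 z • fun _ => (1:ℂ)) 0 1
      = ((Real.circleAverage (poissonKernel 0 z) 0 1 : ℝ) : ℂ) := by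
    simp only [Real.circleAverage_def]
    simp [Pi.smul_apply', intervalIntegral.integral_ofReal]
  rw [h4] at h1
  exact_mod_cast h1


theorem norm_radial_lt {r : ℝ} (hr : r ∈ Ioo (0 : ℝ) 1) (x : Circle) : ‖(r : ℂ) * x‖ < 1 := by
  rw [norm_mul, Circle.norm_coe, Complex.norm_real, Real.norm_eq_abs, abs_of_pos hr.1]
  linarith [hr.2]

theorem norm_radial {r : ℝ} (hr : r ∈ Ioo (0 : ℝ) 1) (x : Circle) : ‖(r : ℂ) * x‖ = r := by
  rw [norm_mul, Circle.norm_coe, Complex.norm_real, Real.norm_eq_abs, abs_of_pos hr.1, mul_one]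

theorem norm_sub_radial_comm (r : ℝ) (x y : Circle) :
    ‖(y : ℂ) - r * x‖ = ‖(x : ℂ) - r * y‖ := by
  have h : ∀ a b : Circle, ‖(a : ℂ) - r * b‖ ^ 2 = 1 + r ^ 2 - 2 * r * (a * (starRingEnd ℂ) b : ℂ).re := by
    intro a b
    have ha : (a : ℂ).re ^ 2 + (a : ℂ).im ^ 2 = 1 := by
      have := Circle.normSq_coe a
      rw [Complex.normSq_apply] at this; nlinarith
    have hb : (b : ℂ).re ^ 2 + (b : ℂ).im ^ 2 = 1 := by
      have := Circle.normSq_coe b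
      rw [Complex.normSq_apply] at this; nlinarith
    rw [← Complex.normSq_eq_norm_sq, Complex.normSq_apply]
    simp
    linear_combination ha + r ^ 2 * hb
  have h2 : ‖(y : ℂ) - r * x‖ ^ 2 = ‖(x : ℂ) - r * y‖ ^ 2 := by
    rw [h, h]
    simp only [Complex.mul_re, Complex.conj_re, Complex.conj_im]
    ring
  exact (pow_left_inj₀ (norm_nonneg _) (norm_nonneg _) two_ne_zero).1 h2

theorem poissonK_radial_comm {r : ℝ} (hr : r ∈ Ioo (0 : ℝ) 1) (x y : Circle) :
    poissonK (r * x) y = poissonK (r * y) x := by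
  simp only [poissonK, norm_sub_radial_comm r x y, norm_radial hr]

theorem continuous_poissonK_radial {r : ℝ} (hr : r ∈ Ioo (0 : ℝ) 1) :
    Continuous fun p : Circle × Circle => poissonK (r * p.1) p.2 := by
  unfold poissonK
  refine Continuous.div (by fun_prop) (by fun_prop) fun p => ?_
  have := one_sub_norm_pos_and_le p.2 (norm_radial_lt hr p.1)
  have : 0 < ‖(p.2 : ℂ) - r * p.1‖ := by linarith
  positivity

/-- The Poisson integral of a function on the circle. -/
noncomputable def poissonInt (u : Circle → ℝ) (z : ℂ) : ℝ := ∫ y, poissonK z y * u y ∂circleMeasure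

theorem integrable_poissonK_mul {z : ℂ} (hz : ‖z‖ < 1) {u : Circle → ℝ}
    (hu : Integrable u circleMeasure) : Integrable (fun y => poissonK z y * u y) circleMeasure := by
  obtain ⟨C, hC⟩ := isCompact_univ.exists_bound_of_continuousOn (continuous_poissonK hz).continuousOn
  exact hu.bdd_mul (continuous_poissonK hz).aestronglyMeasurable
    (Eventually.of_forall fun x => hC x (mem_univ x))

theorem stronglyMeasurable_poissonInt_radial {r : ℝ} (hr : r ∈ Ioo (0 : ℝ) 1) {u : Circle → ℝ}
    (hu : StronglyMeasurable u) : StronglyMeasurable fun x : Circle => poissonInt u (r * x) := by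
  unfold poissonInt
  apply StronglyMeasurable.integral_prod_right'
    (f := fun p : Circle × Circle => poissonK (r * p.1) p.2 * u p.2)
  exact (continuous_poissonK_radial hr).stronglyMeasurable.mul (hu.comp_measurable measurable_snd)

theorem lintegral_poissonK {z : ℂ} (hz : ‖z‖ < 1) :
    ∫⁻ x, ‖poissonK z x‖ₑ ∂circleMeasure = 1 := by
  have hi : Integrable (poissonK z) circleMeasure := by
    simpa using integrable_poissonK_mul hz (integrable_const (1 : ℝ))
  have := ofReal_integral_eq_lintegral_ofReal hi (Eventually.of_forall (poissonK_nonneg hz))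
  rw [integral_poissonK hz, ENNReal.ofReal_one] at this
  rw [this]
  refine lintegral_congr fun x => ?_
  rw [Real.enorm_of_nonneg (poissonK_nonneg hz x)]

/-- Radial dilation of the Poisson integral is a contraction of `L¹`, by the symmetry of the kernel. -/
theorem lintegral_poissonInt_radial_le {r : ℝ} (hr : r ∈ Ioo (0 : ℝ) 1) {u : Circle → ℝ}
    (hu : StronglyMeasurable u) :
    ∫⁻ x : Circle, ‖poissonInt u (r * x)‖ₑ ∂circleMeasure ≤ ∫⁻ x, ‖u x‖ₑ ∂circleMeasure := by
  calc ∫⁻ x : Circle, ‖poissonInt u (r * x)‖ₑ ∂circleMeasure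
      ≤ ∫⁻ x : Circle, ∫⁻ y, ‖poissonK (r * x) y‖ₑ * ‖u y‖ₑ ∂circleMeasure ∂circleMeasure := by
        refine lintegral_mono fun x => ?_
        refine (enorm_integral_le_lintegral_enorm _).trans (le_of_eq ?_)
        simp [enorm_mul]
    _ = ∫⁻ y, ∫⁻ x : Circle, ‖poissonK (r * x) y‖ₑ * ‖u y‖ₑ ∂circleMeasure ∂circleMeasure := by
        refine lintegral_lintegral_swap ?_
        exact ((continuous_poissonK_radial hr).measurable.enorm.mul
          (hu.measurable.comp measurable_snd).enorm).aemeasurable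
    _ = ∫⁻ y, ‖u y‖ₑ ∂circleMeasure := by
        refine lintegral_congr fun y => ?_
        simp_rw [poissonK_radial_comm hr _ y]
        rw [lintegral_mul_const _ (continuous_poissonK (norm_radial_lt hr y)).measurable.enorm,
          lintegral_poissonK (norm_radial_lt hr y), one_mul]

theorem eventually_radial : ∀ᶠ r in 𝓝[<] (1 : ℝ), r ∈ Ioo (0 : ℝ) 1 :=
  Ioo_mem_nhdsLT zero_lt_one

theorem tendsto_poissonInt_radial {u : Circle → ℝ} (hu : Continuous u) (x : Circle) :
    Tendsto (fun r : ℝ => poissonInt u (r * x)) (𝓝[<] 1) (𝓝 (u x)) := by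
  have := tendsto_setIntegral_peak_smul_of_integrableOn_of_tendsto (μ := circleMeasure)
    (φ := fun r : ℝ => poissonK (r * x)) (l := 𝓝[<] (1 : ℝ)) (g := u) (a := u x) (x₀ := x)
    (s := univ) (t := univ) MeasurableSet.univ MeasurableSet.univ subset_rfl Filter.univ_mem
    (by simp) ?_ ?_ ?_ ?_ ?_ ?_
  · simpa [poissonInt] using this
  · filter_upwards [eventually_radial] with r hr y _ using poissonK_nonneg (norm_radial_lt hr x) y
  · intro v hv hxv
    obtain ⟨ρ, hρ, hball⟩ := Metric.isOpen_iff.1 hv x hxv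
    rw [Metric.tendstoUniformlyOn_iff]
    intro ε hε
    have hlim : Tendsto (fun r : ℝ => (1 - r ^ 2) * (16 / ρ ^ 2)) (𝓝[<] 1) (𝓝 0) := by
      have : Continuous fun r : ℝ => (1 - r ^ 2) * (16 / ρ ^ 2) := by fun_prop
      have := this.tendsto 1
      simp only [one_pow, sub_self, zero_mul] at this
      exact this.mono_left nhdsWithin_le_nhds
    filter_upwards [eventually_radial, hlim.eventually (gt_mem_nhds hε)] with r hr hr2 y hy
    have hd : ρ ≤ ‖(y : ℂ) - x‖ := by
      by_contra hcon
      exact hy.2 (hball (by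
        change dist (y : ℂ) x < ρ
        rw [dist_eq_norm]; linarith))
    have h1 : ‖(y : ℂ) - x‖ ≤ 2 * ‖(y : ℂ) - r * x‖ := by
      have ha := one_sub_norm_pos_and_le y (norm_radial_lt hr x)
      rw [norm_radial hr] at ha
      have hb : ‖(r : ℂ) * x - x‖ = 1 - r := by
        rw [← sub_one_mul, norm_mul, Circle.norm_coe, mul_one,
          show (r : ℂ) - 1 = ((r - 1 : ℝ) : ℂ) by push_cast; ring, Complex.norm_real,
          Real.norm_eq_abs, abs_of_neg (by linarith [hr.2])]
        ring
      have hc := norm_sub_le_norm_sub_add_norm_sub (y : ℂ) (r * x) x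
      linarith
    have h2 : ρ / 4 ≤ ‖(y : ℂ) - r * x‖ := by linarith
    simp only [Pi.zero_apply, dist_zero_left, Real.norm_eq_abs]
    rw [abs_of_nonneg (poissonK_nonneg (norm_radial_lt hr x) y)]
    refine lt_of_le_of_lt ?_ hr2
    rw [poissonK, norm_radial hr]
    have h3 : 0 ≤ 1 - r ^ 2 := by nlinarith [hr.1, hr.2]
    rw [div_eq_mul_inv]
    refine mul_le_mul_of_nonneg_left ?_ h3
    rw [show 16 / ρ ^ 2 = ((ρ / 4) ^ 2)⁻¹ by field_simp; norm_num]
    gcongr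
  · refine Tendsto.congr' ?_ tendsto_const_nhds
    filter_upwards [eventually_radial] with r hr
    rw [setIntegral_univ, integral_poissonK (norm_radial_lt hr x)]
  · filter_upwards [eventually_radial] with r hr
    exact (continuous_poissonK (norm_radial_lt hr x)).aestronglyMeasurable
  · rw [integrableOn_univ]
    obtain ⟨C, hC⟩ := isCompact_univ.exists_bound_of_continuousOn hu.continuousOn
    exact Integrable.of_bound hu.aestronglyMeasurable C (Eventually.of_forall fun x => hC x (mem_univ x))
  · rw [nhdsWithin_univ]
    exact hu.tendsto x

theorem abs_poissonInt_le {u : Circle → ℝ} (hu : Integrable u circleMeasure) {B : ℝ}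
    (hB : ∀ x, |u x| ≤ B) {z : ℂ}
    (hz : ‖z‖ < 1) : |poissonInt u z| ≤ B := by
  have hi : Integrable (poissonK z) circleMeasure := by
    simpa using integrable_poissonK_mul hz (integrable_const (1 : ℝ))
  calc |poissonInt u z| ≤ ∫ y, |poissonK z y * u y| ∂circleMeasure := abs_integral_le_integral_abs
    _ ≤ ∫ y, poissonK z y * B ∂circleMeasure := by
        refine integral_mono (integrable_poissonK_mul hz hu).abs (hi.mul_const B) fun y => ?_
        simp only [abs_mul, abs_of_nonneg (poissonK_nonneg hz y)]
        exact mul_le_mul_of_nonneg_left (hB y) (poissonK_nonneg hz y)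
    _ = B := by rw [integral_mul_const, integral_poissonK hz, one_mul]

theorem tendsto_lintegral_poissonInt_sub_of_continuous {u : Circle → ℝ} (hu : Continuous u) :
    Tendsto (fun r : ℝ => ∫⁻ x : Circle, ‖poissonInt u (r * x) - u x‖ₑ ∂circleMeasure)
      (𝓝[<] 1) (𝓝 0) := by
  obtain ⟨C, hC⟩ := isCompact_univ.exists_bound_of_continuousOn hu.continuousOn
  have hC' : ∀ x, |u x| ≤ C := fun x => hC x (mem_univ x)
  have hi : Integrable u circleMeasure := Integrable.of_bound hu.aestronglyMeasurable C
    (Eventually.of_forall hC')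
  have := tendsto_lintegral_filter_of_dominated_convergence (μ := circleMeasure) (l := 𝓝[<] (1 : ℝ))
    (F := fun (r : ℝ) (x : Circle) => ‖poissonInt u (r * x) - u x‖ₑ) (f := fun _ => 0)
    (fun _ => ENNReal.ofReal (2 * C)) ?_ ?_ (by simp [-ENNReal.ofReal_mul]) ?_
  · simpa using this
  · filter_upwards [eventually_radial] with r hr
    exact ((stronglyMeasurable_poissonInt_radial hr hu.stronglyMeasurable).measurable.sub
      hu.measurable).enorm
  · filter_upwards [eventually_radial] with r hr
    refine Eventually.of_forall fun x => ?_
    rw [Real.enorm_eq_ofReal_abs]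
    refine ENNReal.ofReal_le_ofReal ?_
    have h1 := abs_poissonInt_le hi hC' (norm_radial_lt hr x)
    have h2 := hC' x
    calc |poissonInt u (r * x) - u x| ≤ |poissonInt u (r * x)| + |u x| := abs_sub _ _
      _ ≤ 2 * C := by linarith
  · refine Eventually.of_forall fun x => ?_
    have := ((tendsto_poissonInt_radial hu x).sub_const (u x)).enorm
    simpa using this

theorem poissonInt_sub {u v : Circle → ℝ} (hu : Integrable u circleMeasure)
    (hv : Integrable v circleMeasure) {z : ℂ} (hz : ‖z‖ < 1) :
    poissonInt (u - v) z = poissonInt u z - poissonInt v z := by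
  unfold poissonInt
  rw [← integral_sub (integrable_poissonK_mul hz hu) (integrable_poissonK_mul hz hv)]
  simp [mul_sub]

/-- Radial dilations of the Poisson integral of an integrable function converge to it in `L¹`. -/
theorem tendsto_lintegral_poissonInt_sub {u : Circle → ℝ} (hm : StronglyMeasurable u)
    (hu : Integrable u circleMeasure) :
    Tendsto (fun r : ℝ => ∫⁻ x : Circle, ‖poissonInt u (r * x) - u x‖ₑ ∂circleMeasure)
      (𝓝[<] 1) (𝓝 0) := by
  rw [ENNReal.tendsto_nhds_zero]
  intro ε hε
  have hε3 : ε / 3 ≠ 0 := (ENNReal.div_pos hε.ne' (by norm_num)).ne'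
  obtain ⟨v, hv, hvi⟩ := (memLp_one_iff_integrable.2 hu).exists_boundedContinuous_eLpNorm_sub_le
    ENNReal.one_ne_top hε3
  rw [eLpNorm_one_eq_lintegral_enorm] at hv
  have hvi' := memLp_one_iff_integrable.1 hvi
  have h1 := tendsto_lintegral_poissonInt_sub_of_continuous v.continuous
  rw [ENNReal.tendsto_nhds_zero] at h1
  filter_upwards [h1 (ε / 3) (pos_iff_ne_zero.2 hε3), eventually_radial] with r h2 hr
  have h3 := lintegral_poissonInt_radial_le hr (hm.sub v.continuous.stronglyMeasurable)
  calc ∫⁻ x : Circle, ‖poissonInt u (r * x) - u x‖ₑ ∂circleMeasure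
      ≤ ∫⁻ x : Circle, (‖poissonInt (u - v) (r * x)‖ₑ + ‖poissonInt v (r * x) - v x‖ₑ) + ‖(u - v) x‖ₑ
          ∂circleMeasure := by
        refine lintegral_mono fun x => ?_
        rw [poissonInt_sub hu hvi' (norm_radial_lt hr x)]
        have : poissonInt u (r * x) - u x = (poissonInt u (r * x) - poissonInt v (r * x))
          + (poissonInt v (r * x) - v x) - (u - v) x := by simp
        rw [this]
        exact (enorm_sub_le).trans (add_le_add_left (enorm_add_le _ _) _)
    _ = ∫⁻ x : Circle, ‖poissonInt (u - v) (r * x)‖ₑ ∂circleMeasure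
        + ∫⁻ x : Circle, ‖poissonInt v (r * x) - v x‖ₑ ∂circleMeasure
        + ∫⁻ x, ‖(u - v) x‖ₑ ∂circleMeasure := by
        have hm1 : Measurable fun x : Circle => ‖poissonInt (u - v) (r * x)‖ₑ :=
          (stronglyMeasurable_poissonInt_radial hr
          (hm.sub v.continuous.stronglyMeasurable)).measurable.enorm
        have hm2 : Measurable fun x : Circle => ‖poissonInt v (r * x) - v x‖ₑ :=
          ((stronglyMeasurable_poissonInt_radial hr
          v.continuous.stronglyMeasurable).measurable.sub v.continuous.measurable).enorm
        rw [← lintegral_add_left hm1]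
        exact lintegral_add_left (hm1.add hm2) _
    _ ≤ ε / 3 + ε / 3 + ε / 3 := add_le_add (add_le_add (h3.trans hv) h2) hv
    _ = ε := ENNReal.add_thirds ε

/-- For a bounded function `u`, exponentials of radial dilations of its Poisson integral approximate
the exponential of `u` in `L¹` of any finite absolutely continuous measure. -/
theorem exists_radial_exp_approx {u : Circle → ℝ} (hm : StronglyMeasurable u) {B : ℝ}
    (hB : ∀ x, |u x| ≤ B) {s : ℝ} (hs : 0 < s) {ν : Measure Circle} [IsFiniteMeasure ν]
    (hν : ν ≪ circleMeasure) {ε : ℝ≥0∞} (hε : 0 < ε) :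
    ∃ r ∈ Ioo (0 : ℝ) 1,
      ∫⁻ x : Circle, ‖Real.exp (s * poissonInt u (r * x)) - Real.exp (s * u x)‖ₑ ∂ν ≤ ε := by
  have hu : Integrable u circleMeasure := Integrable.of_bound hm.aestronglyMeasurable B
    (Eventually.of_forall hB)
  obtain ⟨ρ, hρmem, hρlim⟩ : ∃ ρ : ℕ → ℝ, (∀ n, ρ n ∈ Ioo (0 : ℝ) 1) ∧
      Tendsto ρ atTop (𝓝[<] 1) := by
    obtain ⟨ρ, -, h1, h2⟩ := exists_seq_strictMono_tendsto' (zero_lt_one (α := ℝ))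
    exact ⟨ρ, h1, tendsto_nhdsWithin_iff.2 ⟨h2, Eventually.of_forall fun n => (h1 n).2⟩⟩
  have hL1 := (tendsto_lintegral_poissonInt_sub hm hu).comp hρlim
  have hmeas := fun n => stronglyMeasurable_poissonInt_radial (hρmem n) hm
  have hTM : TendstoInMeasure circleMeasure (fun n (x : Circle) => poissonInt u (ρ n * x)) atTop u := by
    refine tendstoInMeasure_of_tendsto_eLpNorm (p := 1) one_ne_zero
      (fun n => (hmeas n).aestronglyMeasurable) hm.aestronglyMeasurable ?_
    simp_rw [eLpNorm_one_eq_lintegral_enorm]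
    exact hL1
  obtain ⟨ns, -, hae⟩ := hTM.exists_seq_tendsto_ae
  have hae' := hν.ae_le hae
  have := tendsto_lintegral_of_dominated_convergence (μ := ν)
    (F := fun k (x : Circle) => ‖Real.exp (s * poissonInt u (ρ (ns k) * x)) - Real.exp (s * u x)‖ₑ)
    (f := fun _ => 0) (fun _ => ENNReal.ofReal (2 * Real.exp (s * B))) ?_ ?_ ?_ ?_
  · rw [lintegral_zero, ENNReal.tendsto_nhds_zero] at this
    obtain ⟨k, hk⟩ := (this ε hε).exists
    exact ⟨ρ (ns k), hρmem _, hk⟩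
  · intro k
    exact ((((hmeas (ns k)).measurable.const_mul s).exp).sub
      ((hm.measurable.const_mul s).exp)).enorm
  · intro k
    refine Eventually.of_forall fun x => ?_
    beta_reduce
    rw [Real.enorm_eq_ofReal_abs]
    refine ENNReal.ofReal_le_ofReal ?_
    have h1 := (abs_le.1 (abs_poissonInt_le hu hB (norm_radial_lt (hρmem (ns k)) x))).2
    have h2 := (abs_le.1 (hB x)).2
    have h3 : Real.exp (s * poissonInt u (ρ (ns k) * x)) ≤ Real.exp (s * B) := by gcongr
    have h4 : Real.exp (s * u x) ≤ Real.exp (s * B) := by gcongr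
    refine (abs_sub _ _).trans ?_
    rw [abs_of_pos (Real.exp_pos _), abs_of_pos (Real.exp_pos _)]
    linarith
  · rw [lintegral_const]
    exact ENNReal.mul_ne_top ENNReal.ofReal_ne_top (measure_ne_top _ _)
  · filter_upwards [hae'] with x hx
    have h1 : Tendsto (fun k => Real.exp (s * poissonInt u (ρ (ns k) * x))) atTop
        (𝓝 (Real.exp (s * u x))) := (Real.continuous_exp.tendsto _).comp (hx.const_mul s)
    have := (h1.sub_const (Real.exp (s * u x))).enorm
    simpa using this

/-! ### Cauchy integrals of balanced densities -/

/-- A density `ψ` on the circle, bounded by `B`, is balanced on the finite disjoint family of sets `I i`, of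
diameter at most `δ`, if it is carried by these sets, has mean zero on each of them, and the positive
part of `ψ` has average at most `A` on each of them. -/
structure Balanced {ι : Type*} (I : ι → Set Circle) (δ A B : ℝ) (ψ : Circle → ℝ) : Prop where
  measurableSet : ∀ i, MeasurableSet (I i)
  nonempty : ∀ i, (I i).Nonempty
  disjoint : Pairwise (Function.onFun Disjoint I)
  diam_le : ∀ i, ∀ x ∈ I i, ∀ y ∈ I i, ‖(x : ℂ) - y‖ ≤ δ
  measurable : StronglyMeasurable ψ
  abs_le : ∀ x, |ψ x| ≤ B
  eq_zero : ∀ x, x ∉ ⋃ i, I i → ψ x = 0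
  mean_zero : ∀ i, ∫ x in I i, ψ x ∂circleMeasure = 0
  pos_le : ∀ i, ∫ x in I i, max (ψ x) 0 ∂circleMeasure ≤ A * circleMeasure.real (I i)

/-- A bound by a multiple of `m(J) f(y)` that holds for every `y ∈ J` is averaged over `y`. -/
theorem average_le {J : Set Circle} (hJ : MeasurableSet J) (hne : J.Nonempty) {K M : ℝ}
    {f : Circle → ℝ} (hf : Integrable f circleMeasure)
    (h : ∀ y ∈ J, K ≤ M * circleMeasure.real J * f y) :
    K ≤ M * ∫ y in J, f y ∂circleMeasure := by
  have hfJ : IntegrableOn f J circleMeasure := hf.integrableOn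
  rcases eq_or_ne (circleMeasure J) 0 with h0 | h0
  · have : circleMeasure.restrict J = 0 := Measure.restrict_eq_zero.2 h0
    rw [this, integral_zero_measure]
    obtain ⟨y, hy⟩ := hne
    have := h y hy
    rw [measureReal_def, h0] at this
    simpa using this
  · have hpos : 0 < circleMeasure.real J := ENNReal.toReal_pos h0 (measure_ne_top _ _)
    have h1 : ∫ _ in J, K ∂circleMeasure ≤ ∫ y in J, M * circleMeasure.real J * f y ∂circleMeasure :=
      setIntegral_mono_on (integrable_const _) (hfJ.const_mul _) hJ h
    rw [integral_const_mul, setIntegral_const, smul_eq_mul] at h1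
    have h2 : circleMeasure.real J * K ≤ circleMeasure.real J * (M * ∫ y in J, f y ∂circleMeasure) := by
      linarith
    exact le_of_mul_le_mul_left h2 hpos

/-- The Cauchy integral `2 ∫ ψ(x) / (x - z) dm(x)`. -/
noncomputable def cauchyInt (ψ : Circle → ℝ) (z : ℂ) : ℂ :=
  2 * ∫ x : Circle, (ψ x : ℂ) * ((x : ℂ) - z)⁻¹ ∂circleMeasure

theorem coe_sub_ne_zero (x : Circle) {z : ℂ} (hz : ‖z‖ < 1) : (x : ℂ) - z ≠ 0 := by
  have := one_sub_norm_pos_and_le x hz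
  exact norm_pos_iff.1 (by linarith)

theorem continuous_inv_sub {z : ℂ} (hz : ‖z‖ < 1) : Continuous fun x : Circle => ((x : ℂ) - z)⁻¹ :=
  Continuous.inv₀ (by fun_prop) fun x => coe_sub_ne_zero x hz

theorem integrable_mul_inv_sub {ψ : Circle → ℝ} (hψ : Integrable ψ circleMeasure) {z : ℂ}
    (hz : ‖z‖ < 1) : Integrable (fun x : Circle => (ψ x : ℂ) * ((x : ℂ) - z)⁻¹) circleMeasure := by
  obtain ⟨C, hC⟩ := isCompact_univ.exists_bound_of_continuousOn (continuous_inv_sub hz).continuousOn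
  exact hψ.ofReal.mul_bdd (continuous_inv_sub hz).aestronglyMeasurable
    (Eventually.of_forall fun x => hC x (mem_univ x))

theorem integrable_inv_sq {z : ℂ} (hz : ‖z‖ < 1) :
    Integrable (fun y : Circle => (‖(y : ℂ) - z‖ ^ 2)⁻¹) circleMeasure := by
  have h : Continuous fun y : Circle => (‖(y : ℂ) - z‖ ^ 2)⁻¹ := by
    refine Continuous.inv₀ (by fun_prop) fun x => ?_
    have := norm_pos_iff.2 (coe_sub_ne_zero x hz)
    positivity
  obtain ⟨C, hC⟩ := isCompact_univ.exists_bound_of_continuousOn h.continuousOn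
  exact Integrable.of_bound h.aestronglyMeasurable C (Eventually.of_forall fun x => hC x (mem_univ x))

theorem integral_inv_sq_le {z : ℂ} (hz : ‖z‖ < 1) :
    ∫ y : Circle, (‖(y : ℂ) - z‖ ^ 2)⁻¹ ∂circleMeasure ≤ (1 - ‖z‖)⁻¹ := by
  have h := integral_poissonK hz
  simp only [poissonK, div_eq_mul_inv] at h
  rw [integral_const_mul] at h
  have h0 : 0 < 1 - ‖z‖ := by linarith
  have h1 : 0 < 1 - ‖z‖ ^ 2 := by nlinarith [norm_nonneg z]
  rw [eq_inv_of_mul_eq_one_right h]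
  gcongr
  nlinarith [norm_nonneg z]

theorem differentiableOn_cauchyInt {ψ : Circle → ℝ} (hψ : Integrable ψ circleMeasure) :
    DifferentiableOn ℂ (cauchyInt ψ) (Metric.ball 0 1) := by
  intro z hz
  rw [mem_ball_zero_iff] at hz
  refine DifferentiableAt.differentiableWithinAt ?_
  have hε : 0 < (1 - ‖z‖) / 2 := by linarith
  have hball : ∀ w ∈ Metric.ball z ((1 - ‖z‖) / 2), ‖w‖ < 1 ∧ (1 - ‖z‖) / 2 ≤ 1 - ‖w‖ := by
    intro w hw
    rw [mem_ball_iff_norm] at hw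
    have := norm_le_norm_add_norm_sub z w
    rw [norm_sub_rev z w] at this
    constructor <;> linarith
  have key := hasDerivAt_integral_of_dominated_loc_of_deriv_le (μ := circleMeasure) (𝕜 := ℂ)
    (F := fun (w : ℂ) (x : Circle) => (ψ x : ℂ) * ((x : ℂ) - w)⁻¹) (x₀ := z)
    (F' := fun (w : ℂ) (x : Circle) => (ψ x : ℂ) * (((x : ℂ) - w) ^ 2)⁻¹)
    (bound := fun x => |ψ x| * (((1 - ‖z‖) / 2) ^ 2)⁻¹)
    (Metric.ball_mem_nhds z hε) ?_ (integrable_mul_inv_sub hψ hz) ?_ ?_ (hψ.abs.mul_const _) ?_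
  · exact (key.2.const_mul 2).differentiableAt
  · filter_upwards [Metric.ball_mem_nhds z hε] with w hw
    exact (integrable_mul_inv_sub hψ (hball w hw).1).aestronglyMeasurable
  · refine hψ.ofReal.aestronglyMeasurable.mul (Continuous.aestronglyMeasurable ?_)
    exact Continuous.inv₀ (by fun_prop) fun x => pow_ne_zero 2 (coe_sub_ne_zero x hz)
  · refine Eventually.of_forall fun x w hw => ?_
    obtain ⟨h1, h2⟩ := hball w hw
    have h3 := (one_sub_norm_pos_and_le x h1).2
    rw [norm_mul, Complex.norm_real, Real.norm_eq_abs, norm_inv, norm_pow]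
    gcongr
    linarith
  · refine Eventually.of_forall fun x w hw => ?_
    have h1 := coe_sub_ne_zero x (hball w hw).1
    have h2 := (((hasDerivAt_id w).const_sub (x : ℂ)).inv h1).const_mul (ψ x : ℂ)
    simpa using h2

/-- For a density of mean zero, the Poisson integral is the real part of `z` times the Cauchy
integral, as the Herglotz kernel is `1 + 2 z / (x - z)`. -/
theorem re_mul_cauchyInt {ψ : Circle → ℝ} (hψ : Integrable ψ circleMeasure)
    (h0 : ∫ x, ψ x ∂circleMeasure = 0) {z : ℂ} (hz : ‖z‖ < 1) :
    (z * cauchyInt ψ z).re = poissonInt ψ z := by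
  have h1 : z * cauchyInt ψ z
      = ∫ x : Circle, ((ψ x : ℂ) + 2 * z * ((ψ x : ℂ) * ((x : ℂ) - z)⁻¹)) ∂circleMeasure := by
    refine Eq.trans ?_ (integral_add hψ.ofReal
      ((integrable_mul_inv_sub hψ hz).const_mul (2 * z))).symm
    rw [integral_const_mul, integral_complex_ofReal, h0, cauchyInt]
    push_cast
    ring
  have hi : Integrable (fun x : Circle => (ψ x : ℂ) + 2 * z * ((ψ x : ℂ) * ((x : ℂ) - z)⁻¹))
      circleMeasure := hψ.ofReal.add ((integrable_mul_inv_sub hψ hz).const_mul _)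
  have h2 := integral_re hi
  simp only [RCLike.re_to_complex] at h2
  rw [h1, ← h2, poissonInt]
  refine integral_congr_ae (Eventually.of_forall fun x => ?_)
  have h3 : poissonK z x = (((x : ℂ) + z) / ((x : ℂ) - z)).re := by
    have := congrFun (poissonKernel_eq_re_herglotzRieszKernel (c := 0) (w := z)) (x : ℂ)
    simpa [poissonKernel_def, herglotzRieszKernel_def, poissonK, Circle.norm_coe] using this
  have h4 : (ψ x : ℂ) + 2 * z * ((ψ x : ℂ) * ((x : ℂ) - z)⁻¹)
      = (ψ x : ℂ) * (((x : ℂ) + z) / ((x : ℂ) - z)) := by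
    have := coe_sub_ne_zero x hz
    field_simp
    ring
  beta_reduce
  rw [h4, h3, Complex.re_ofReal_mul, mul_comm]

namespace Balanced

variable {ι : Type*} {I : ι → Set Circle} {δ A B : ℝ} {ψ : Circle → ℝ}

theorem integrable (h : Balanced I δ A B ψ) : Integrable ψ circleMeasure :=
  Integrable.of_bound h.measurable.aestronglyMeasurable B (Eventually.of_forall h.abs_le)

theorem integrable_max (h : Balanced I δ A B ψ) :
    Integrable (fun x => max (ψ x) 0) circleMeasure := h.integrable.pos_part

theorem integral_eq_sum [Fintype ι] (h : Balanced I δ A B ψ)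
    {E : Type*} [NormedAddCommGroup E] [NormedSpace ℝ E] {f : Circle → E} (hf : Integrable f circleMeasure) (h0 : ∀ x, ψ x = 0 → f x = 0) :
    ∫ x, f x ∂circleMeasure = ∑ i, ∫ x in I i, f x ∂circleMeasure := by
  rw [← integral_biUnion_finset Finset.univ (fun i _ => h.measurableSet i)
    (fun i _ j _ hij => h.disjoint hij) (fun i _ => hf.integrableOn)]
  refine (setIntegral_eq_integral_of_forall_compl_eq_zero fun x hx => h0 x (h.eq_zero x ?_)).symm
  simpa using hx

theorem integral_eq_zero [Fintype ι] (h : Balanced I δ A B ψ) : ∫ x, ψ x ∂circleMeasure = 0 := by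
  rw [h.integral_eq_sum h.integrable (fun _ => id)]
  exact Finset.sum_eq_zero fun i _ => h.mean_zero i

theorem sum_setIntegral_le [Fintype ι] (h : Balanced I δ A B ψ)
    {f : Circle → ℝ} (hf : Integrable f circleMeasure) (h0 : ∀ x, 0 ≤ f x) : ∑ i, ∫ x in I i, f x ∂circleMeasure ≤ ∫ x, f x ∂circleMeasure := by
  rw [← integral_biUnion_finset Finset.univ (fun i _ => h.measurableSet i)
    (fun i _ j _ hij => h.disjoint hij) (fun i _ => hf.integrableOn)]
  exact setIntegral_le_integral hf (Eventually.of_forall h0)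

theorem sum_measureReal_le [Fintype ι] (h : Balanced I δ A B ψ) :
    ∑ i, circleMeasure.real (I i) ≤ 1 := by
  have := h.sum_setIntegral_le (integrable_const (1 : ℝ)) (fun _ => zero_le_one)
  simpa using this

theorem setIntegral_abs_le (h : Balanced I δ A B ψ) (i : ι) :
    ∫ x in I i, |ψ x| ∂circleMeasure ≤ 2 * A * circleMeasure.real (I i) := by
  have h1 : ∀ x, |ψ x| = 2 * max (ψ x) 0 - ψ x := by
    intro x
    rcases le_total 0 (ψ x) with hx | hx
    · rw [abs_of_nonneg hx, max_eq_left hx]; ring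
    · rw [abs_of_nonpos hx, max_eq_right hx]; ring
  simp_rw [h1]
  rw [integral_sub (h.integrable_max.integrableOn.const_mul 2) h.integrable.integrableOn,
    integral_const_mul, h.mean_zero i]
  linarith [h.pos_le i]

/-- The mean zero condition turns the Cauchy integral over `I i` into an oscillation of the kernel. -/
theorem norm_setIntegral_le (h : Balanced I δ A B ψ) (i : ι) {z : ℂ} (hz : ‖z‖ < 1) {y : Circle}
    {κ : ℝ} (hκ0 : 0 ≤ κ) (hκ : ∀ x ∈ I i, ‖((x : ℂ) - z)⁻¹ - ((y : ℂ) - z)⁻¹‖ ≤ κ) :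
    ‖∫ x in I i, (ψ x : ℂ) * ((x : ℂ) - z)⁻¹ ∂circleMeasure‖
      ≤ κ * (2 * A * circleMeasure.real (I i)) := by
  have h1 : ∫ x in I i, (ψ x : ℂ) * ((x : ℂ) - z)⁻¹ ∂circleMeasure
      = ∫ x in I i, (ψ x : ℂ) * (((x : ℂ) - z)⁻¹ - ((y : ℂ) - z)⁻¹) ∂circleMeasure := by
    simp_rw [mul_sub]
    refine Eq.trans ?_ (integral_sub (integrable_mul_inv_sub h.integrable hz).integrableOn
      (h.integrable.ofReal.mul_const (((y : ℂ) - z)⁻¹)).integrableOn).symm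
    have h2 : ∫ x in I i, (ψ x : ℂ) ∂circleMeasure = 0 := by
      rw [integral_complex_ofReal, h.mean_zero i, Complex.ofReal_zero]
    rw [integral_mul_const]
    change _ = (∫ x in I i, (ψ x : ℂ) * ((x : ℂ) - z)⁻¹ ∂circleMeasure)
      - (∫ x in I i, (ψ x : ℂ) ∂circleMeasure) * ((y : ℂ) - z)⁻¹
    rw [h2, zero_mul, sub_zero]
  rw [h1]
  refine (norm_integral_le_integral_norm _).trans ?_
  calc ∫ x in I i, ‖(ψ x : ℂ) * (((x : ℂ) - z)⁻¹ - ((y : ℂ) - z)⁻¹)‖ ∂circleMeasure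
      ≤ ∫ x in I i, κ * |ψ x| ∂circleMeasure := by
        refine setIntegral_mono_on ?_ (h.integrable.abs.const_mul κ).integrableOn (h.measurableSet i)
          fun x hx => ?_
        · refine Integrable.integrableOn (Integrable.norm ?_)
          simp_rw [mul_sub]
          exact (integrable_mul_inv_sub h.integrable hz).sub (h.integrable.ofReal.mul_const _)
        · rw [norm_mul, Complex.norm_real, Real.norm_eq_abs, mul_comm]
          exact mul_le_mul_of_nonneg_right (hκ x hx) (abs_nonneg _)
    _ ≤ κ * (2 * A * circleMeasure.real (I i)) := by
        rw [integral_const_mul]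
        exact mul_le_mul_of_nonneg_left (h.setIntegral_abs_le i) hκ0

theorem norm_inv_sub_inv {a b : ℂ} (ha : a ≠ 0) (hb : b ≠ 0) :
    ‖a⁻¹ - b⁻¹‖ = ‖a - b‖ / (‖a‖ * ‖b‖) := by
  rw [inv_sub_inv ha hb, norm_div, norm_mul, norm_sub_rev]

theorem norm_cauchyInt_le_sum [Fintype ι] (h : Balanced I δ A B ψ) {z : ℂ} (hz : ‖z‖ < 1) :
    ‖cauchyInt ψ z‖ ≤ 2 * ∑ i, ‖∫ x in I i, (ψ x : ℂ) * ((x : ℂ) - z)⁻¹ ∂circleMeasure‖ := by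
  rw [cauchyInt, norm_mul, h.integral_eq_sum (integrable_mul_inv_sub h.integrable hz)
    (fun x hx => by simp [hx])]
  simp only [Complex.norm_ofNat]
  gcongr
  exact norm_sum_le _ _

/-- Away from the sets `I i`, the Cauchy integral of a balanced density is small. -/
theorem norm_cauchyInt_le_of_far [Fintype ι] (h : Balanced I δ A B ψ) (hA : 0 ≤ A) (hδ : 0 ≤ δ) {z : ℂ}
    (hz : ‖z‖ < 1) {ρ : ℝ} (hρ : 0 < ρ) (hfar : ∀ i, ∀ x ∈ I i, ρ ≤ ‖(x : ℂ) - z‖) :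
    ‖cauchyInt ψ z‖ ≤ 4 * A * δ / ρ ^ 2 := by
  refine (h.norm_cauchyInt_le_sum hz).trans ?_
  have h1 : ∀ i, ‖∫ x in I i, (ψ x : ℂ) * ((x : ℂ) - z)⁻¹ ∂circleMeasure‖
      ≤ δ / ρ ^ 2 * (2 * A) * circleMeasure.real (I i) := by
    intro i
    obtain ⟨y, hy⟩ := h.nonempty i
    have := h.norm_setIntegral_le i hz (y := y) (κ := δ / ρ ^ 2) (by positivity) fun x hx => by
      rw [norm_inv_sub_inv (coe_sub_ne_zero x hz) (coe_sub_ne_zero y hz), sub_sub_sub_cancel_right,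
        sq]
      have := h.diam_le i x hx y hy
      have := hfar i x hx
      have := hfar i y hy
      gcongr
    linarith
  calc 2 * ∑ i, ‖∫ x in I i, (ψ x : ℂ) * ((x : ℂ) - z)⁻¹ ∂circleMeasure‖
      ≤ 2 * ∑ i, δ / ρ ^ 2 * (2 * A) * circleMeasure.real (I i) := by
        gcongr with i
        exact h1 i
    _ = 4 * A * δ / ρ ^ 2 * ∑ i, circleMeasure.real (I i) := by rw [← Finset.mul_sum]; ring
    _ ≤ 4 * A * δ / ρ ^ 2 * 1 := by
        gcongr
        exact h.sum_measureReal_le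
    _ = _ := mul_one _

/-- At distance at least `δ` from the circle, the oscillation of the Cauchy kernel over each `I i`
makes the Cauchy integral of order `A δ / (1 - |z|)`. -/
theorem norm_cauchyInt_le [Fintype ι] (h : Balanced I δ A B ψ) (hA : 0 ≤ A) (hδ : 0 ≤ δ) {z : ℂ}
    (hz : ‖z‖ < 1) (hδz : δ ≤ 1 - ‖z‖) :
    ‖cauchyInt ψ z‖ ≤ 8 * A * δ / (1 - ‖z‖) := by
  refine (h.norm_cauchyInt_le_sum hz).trans ?_
  have h1 : ∀ i, ‖∫ x in I i, (ψ x : ℂ) * ((x : ℂ) - z)⁻¹ ∂circleMeasure‖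
      ≤ 4 * A * δ * ∫ y in I i, (‖(y : ℂ) - z‖ ^ 2)⁻¹ ∂circleMeasure := by
    intro i
    refine average_le (h.measurableSet i) (h.nonempty i) (integrable_inv_sq hz) fun y hy => ?_
    have := h.norm_setIntegral_le i hz (y := y) (κ := 2 * δ * (‖(y : ℂ) - z‖ ^ 2)⁻¹) (by positivity)
      fun x hx => by
      have hx1 := one_sub_norm_pos_and_le x hz
      have hy1 := one_sub_norm_pos_and_le y hz
      rw [norm_inv_sub_inv (coe_sub_ne_zero x hz) (coe_sub_ne_zero y hz), sub_sub_sub_cancel_right]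
      have h2 := h.diam_le i x hx y hy
      -- the two distances are comparable because `|x - y| ≤ δ ≤ 1 - |z| ≤ |x - z|`
      have h3 : ‖(y : ℂ) - z‖ ≤ 2 * ‖(x : ℂ) - z‖ := by
        have := norm_sub_le_norm_sub_add_norm_sub (y : ℂ) x z
        rw [norm_sub_rev (y : ℂ) x] at this
        linarith
      have hypos : 0 < ‖(y : ℂ) - z‖ := by linarith
      have hxpos : 0 < ‖(x : ℂ) - z‖ := by linarith
      rw [← div_eq_mul_inv, div_le_div_iff₀ (by positivity) (by positivity)]
      calc ‖(x : ℂ) - y‖ * ‖(y : ℂ) - z‖ ^ 2 ≤ δ * (2 * ‖(x : ℂ) - z‖ * ‖(y : ℂ) - z‖) := by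
            rw [sq]; gcongr
        _ = _ := by ring
    calc _ ≤ _ := this
      _ = _ := by ring
  calc 2 * ∑ i, ‖∫ x in I i, (ψ x : ℂ) * ((x : ℂ) - z)⁻¹ ∂circleMeasure‖
      ≤ 2 * ∑ i, 4 * A * δ * ∫ y in I i, (‖(y : ℂ) - z‖ ^ 2)⁻¹ ∂circleMeasure := by
        gcongr with i
        exact h1 i
    _ = 8 * A * δ * ∑ i, ∫ y in I i, (‖(y : ℂ) - z‖ ^ 2)⁻¹ ∂circleMeasure := by
        rw [← Finset.mul_sum]; ring
    _ ≤ 8 * A * δ * (1 - ‖z‖)⁻¹ := by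
        gcongr
        exact (h.sum_setIntegral_le (integrable_inv_sq hz) fun x => by positivity).trans
          (integral_inv_sq_le hz)
    _ = _ := by rw [div_eq_mul_inv]

/-- Within distance `δ` of the circle, the Poisson kernel at `z` is compared, Harnack style, with
the kernel at the point `(1 - δ) z / |z|`. -/
theorem poissonInt_le_of_near [Fintype ι] (h : Balanced I δ A B ψ) (hA : 0 ≤ A) (hδ1 : δ ≤ 1) {z : ℂ}
    (hz : ‖z‖ < 1) (hδz : 1 - ‖z‖ < δ) :
    poissonInt ψ z ≤ 32 * A * δ / (1 - ‖z‖) := by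
  have hδ : 0 < δ := by linarith
  have hz0 : 0 < ‖z‖ := by linarith
  have h1z : 0 < 1 - ‖z‖ := by linarith
  set z' : ℂ := ((1 - δ) / ‖z‖ : ℝ) * z with hz'
  have hz'n : ‖z'‖ = 1 - δ := by
    rw [hz', norm_mul, Complex.norm_real, Real.norm_eq_abs, abs_of_nonneg (by
      apply div_nonneg <;> linarith)]
    field_simp
  have hz'1 : ‖z'‖ < 1 := by linarith
  have hzz' : ‖z - z'‖ ≤ δ := by
    have : z - z' = ((1 - (1 - δ) / ‖z‖ : ℝ) : ℂ) * z := by rw [hz']; push_cast; ring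
    rw [this, norm_mul, Complex.norm_real, Real.norm_eq_abs]
    have h2 : |1 - (1 - δ) / ‖z‖| * ‖z‖ = |‖z‖ - (1 - δ)| := by
      rw [← abs_of_pos hz0, ← abs_mul, abs_of_pos hz0]
      congr 1
      field_simp
    rw [h2, _root_.abs_le]
    constructor <;> linarith
  have hi := integrable_poissonK_mul hz h.integrable_max
  have h1 : ∀ i, ∫ x in I i, poissonK z x * max (ψ x) 0 ∂circleMeasure
      ≤ 32 * A * δ ^ 2 / (1 - ‖z‖) * ∫ y in I i, (‖(y : ℂ) - z'‖ ^ 2)⁻¹ ∂circleMeasure := by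
    intro i
    refine average_le (h.measurableSet i) (h.nonempty i) (integrable_inv_sq hz'1) fun y hy => ?_
    have hypos : 0 < ‖(y : ℂ) - z'‖ := norm_pos_iff.2 (coe_sub_ne_zero y hz'1)
    set κ : ℝ := 32 * δ ^ 2 / (1 - ‖z‖) * (‖(y : ℂ) - z'‖ ^ 2)⁻¹ with hκ
    have hκ0 : 0 ≤ κ := by positivity
    have hK : ∀ x ∈ I i, poissonK z x ≤ κ := by
      intro x hx
      obtain ⟨-, hx1⟩ := one_sub_norm_pos_and_le x hz
      have hxpos : 0 < ‖(x : ℂ) - z‖ := by linarith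
      have h2 := h.diam_le i y hy x hx
      have h3 : ‖(y : ℂ) - z'‖ ≤ 2 * (‖(x : ℂ) - z‖ + δ) := by
        have ha := norm_sub_le_norm_sub_add_norm_sub (y : ℂ) x z'
        have hb := norm_sub_le_norm_sub_add_norm_sub (x : ℂ) z z'
        linarith
      -- monotonicity of `s ↦ s / (D + s)` between `1 - |z|` and `δ`
      have h4 : (1 - ‖z‖) * (‖(x : ℂ) - z‖ + δ) ≤ 2 * δ * ‖(x : ℂ) - z‖ := by nlinarith
      have h5 : (1 - ‖z‖) * ‖(y : ℂ) - z'‖ ≤ 4 * δ * ‖(x : ℂ) - z‖ := by nlinarith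
      have h6 : ((1 - ‖z‖) * ‖(y : ℂ) - z'‖) ^ 2 ≤ (4 * δ * ‖(x : ℂ) - z‖) ^ 2 := by gcongr
      rw [hκ, poissonK, ← div_eq_mul_inv, div_div, div_le_div_iff₀ (by positivity) (by positivity)]
      nlinarith [norm_nonneg z, mul_nonneg (mul_nonneg h1z.le h1z.le) (sq_nonneg ‖(y : ℂ) - z'‖)]
    calc ∫ x in I i, poissonK z x * max (ψ x) 0 ∂circleMeasure
        ≤ ∫ x in I i, κ * max (ψ x) 0 ∂circleMeasure := by
          refine setIntegral_mono_on hi.integrableOn (h.integrable_max.const_mul κ).integrableOn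
            (h.measurableSet i) fun x hx => ?_
          exact mul_le_mul_of_nonneg_right (hK x hx) (le_max_right _ _)
      _ ≤ κ * (A * circleMeasure.real (I i)) := by
          rw [integral_const_mul]
          exact mul_le_mul_of_nonneg_left (h.pos_le i) hκ0
      _ = _ := by rw [hκ]; ring
  calc poissonInt ψ z ≤ ∫ x, poissonK z x * max (ψ x) 0 ∂circleMeasure := by
        refine integral_mono (integrable_poissonK_mul hz h.integrable) hi fun x => ?_
        exact mul_le_mul_of_nonneg_left (le_max_left _ _) (poissonK_nonneg hz x)
    _ = ∑ i, ∫ x in I i, poissonK z x * max (ψ x) 0 ∂circleMeasure :=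
        h.integral_eq_sum hi fun x hx => by simp [hx]
    _ ≤ ∑ i, 32 * A * δ ^ 2 / (1 - ‖z‖) * ∫ y in I i, (‖(y : ℂ) - z'‖ ^ 2)⁻¹ ∂circleMeasure :=
        Finset.sum_le_sum fun i _ => h1 i
    _ ≤ 32 * A * δ ^ 2 / (1 - ‖z‖) * (1 - ‖z'‖)⁻¹ := by
        rw [← Finset.mul_sum]
        gcongr
        exact (h.sum_setIntegral_le (integrable_inv_sq hz'1) fun x => by positivity).trans
          (integral_inv_sq_le hz'1)
    _ = 32 * A * δ / (1 - ‖z‖) := by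
        rw [hz'n, sub_sub_cancel]
        field_simp

/-- The Poisson integral of a balanced density is at most of order `A δ / (1 - |z|)`. -/
theorem re_mul_cauchyInt_le [Fintype ι] (h : Balanced I δ A B ψ) (hA : 0 ≤ A) (hδ : 0 ≤ δ)
    (hδ1 : δ ≤ 1) {z : ℂ} (hz : ‖z‖ < 1) : (z * cauchyInt ψ z).re ≤ 32 * A * δ / (1 - ‖z‖) := by
  rcases le_or_gt δ (1 - ‖z‖) with hδz | hδz
  · have h1 := h.norm_cauchyInt_le hA hδ hz hδz
    have hpos : 0 ≤ A * δ / (1 - ‖z‖) := div_nonneg (mul_nonneg hA hδ) (by linarith)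
    calc (z * cauchyInt ψ z).re ≤ ‖z * cauchyInt ψ z‖ := Complex.re_le_norm _
      _ = ‖z‖ * ‖cauchyInt ψ z‖ := norm_mul _ _
      _ ≤ 1 * ‖cauchyInt ψ z‖ := by gcongr
      _ ≤ 8 * A * δ / (1 - ‖z‖) := by rw [one_mul]; exact h1
      _ = 8 * (A * δ / (1 - ‖z‖)) := by ring
      _ ≤ 32 * (A * δ / (1 - ‖z‖)) := by linarith
      _ = _ := by ring
  · rw [re_mul_cauchyInt h.integrable h.integral_eq_zero hz]
    exact h.poissonInt_le_of_near hA hδ1 hz hδz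

end Balanced

/-! ### Balanced densities adapted to the residual set -/

/-- The function `log⁻ w`, with the value `∞` where `w` vanishes. -/
noncomputable def negLog (w : Circle → ℝ) (x : Circle) : ℝ≥0∞ :=
  (-ENNReal.log (ENNReal.ofReal (w x))).toENNReal

theorem measurable_negLog {w : Circle → ℝ} (hw : Measurable w) : Measurable (negLog w) :=
  (hw.ennreal_ofReal.ennreal_log.neg).ereal_toENNReal

theorem negLog_of_pos {w : Circle → ℝ} {x : Circle} (hx : 0 < w x) :
    negLog w x = ENNReal.ofReal (-Real.log (w x)) := by
  rw [negLog, ENNReal.log_ofReal_of_pos hx, ← EReal.coe_neg, EReal.toENNReal_of_ne_top (EReal.coe_ne_top _),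
    EReal.toReal_coe]

/-- Since `log⁺ w ≤ w` is integrable, a divergent `∫_I log w` has a divergent negative part. -/
theorem setLIntegral_negLog_eq_top {w : Circle → ℝ} (hw_int : Integrable w circleMeasure)
    {I : Set Circle} (hI : logIntegral w I = ⊥) : ∫⁻ x in I, negLog w x ∂circleMeasure = ⊤ := by
  by_contra hne
  have hP : ∫⁻ x in I, (ENNReal.log (ENNReal.ofReal (w x))).toENNReal ∂circleMeasure ≠ ⊤ := by
    have h1 : ∫⁻ x, ENNReal.ofReal (w x) ∂circleMeasure ≠ ⊤ := by
      refine ne_top_of_le_ne_top hw_int.2.ne (lintegral_mono fun x => ?_)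
      rw [Real.enorm_eq_ofReal_abs]
      exact ENNReal.ofReal_le_ofReal (le_abs_self _)
    refine ne_top_of_le_ne_top h1 ((setLIntegral_le_lintegral I _).trans (lintegral_mono fun x => ?_))
    rcases le_or_gt (w x) 0 with hx | hx
    · simp [ENNReal.ofReal_of_nonpos hx]
    · rw [ENNReal.log_ofReal_of_pos hx, EReal.toENNReal_of_ne_top (EReal.coe_ne_top _), EReal.toReal_coe]
      refine ENNReal.ofReal_le_ofReal ?_
      linarith [Real.log_le_sub_one_of_pos hx]
  unfold negLog at hne
  rw [logIntegral] at hI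
  lift (∫⁻ x in I, (ENNReal.log (ENNReal.ofReal (w x))).toENNReal ∂circleMeasure) to NNReal using hP
    with P
  lift (∫⁻ x in I, (-ENNReal.log (ENNReal.ofReal (w x))).toENNReal ∂circleMeasure) to NNReal using hne
    with Q
  rw [← EReal.coe_ennreal_toReal (ENNReal.coe_ne_top (r := P)),
    ← EReal.coe_ennreal_toReal (ENNReal.coe_ne_top (r := Q)), ← EReal.coe_sub] at hI
  exact EReal.coe_ne_bot _ hI

/-- On a set where `∫ log w = -∞` there are bounded functions of any prescribed integral, carried by
the part where `w` is small, whose exponential is controlled by `w ^ (-1/2)`. -/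
theorem exists_bump {w : Circle → ℝ} (hw : Measurable w) (hw0 : ∀ x, 0 ≤ w x) {I : Set Circle}
    (hI : MeasurableSet I) (htop : ∫⁻ x in I, negLog w x ∂circleMeasure = ⊤) {s ε c : ℝ} (hs : 0 < s)
    (hε : 0 < ε) (hε1 : ε < 1) (hc : 0 ≤ c) :
    ∃ (p : Circle → ℝ) (B : ℝ), StronglyMeasurable p ∧ (∀ x, 0 ≤ p x) ∧ (∀ x, p x ≤ B) ∧
      (∀ x, p x ≠ 0 → x ∈ I ∧ w x < ε) ∧ ∫ x in I, p x ∂circleMeasure = c ∧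
      ∀ x, Real.exp (s * p x) * w x ≤ w x + √(w x) := by
  rcases hc.eq_or_lt with rfl | hc
  · exact ⟨fun _ => 0, 0, stronglyMeasurable_const, by simp, by simp, by simp, by simp,
      fun x => by simp [Real.sqrt_nonneg]⟩
  set J : Set Circle := I ∩ {x | w x < ε} with hJ
  have hJm : MeasurableSet J := hI.inter (measurableSet_lt hw measurable_const)
  have hum := measurable_negLog hw
  have hJtop : ∫⁻ x in J, negLog w x ∂circleMeasure = ⊤ := by
    by_contra hne
    have h1 := lintegral_inter_add_sdiff (μ := circleMeasure) (negLog w) I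
      (measurableSet_lt hw measurable_const : MeasurableSet {x | w x < ε})
    have h2 : ∫⁻ x in I \ {x | w x < ε}, negLog w x ∂circleMeasure ≠ ⊤ := by
      have hle : ∫⁻ x in I \ {x | w x < ε}, negLog w x ∂circleMeasure
          ≤ ∫⁻ x in I \ {x | w x < ε}, ENNReal.ofReal (-Real.log ε) ∂circleMeasure := by
        refine setLIntegral_mono measurable_const fun x hx => ?_
        have hx2 : ε ≤ w x := not_lt.1 hx.2
        rw [negLog_of_pos (hε.trans_le hx2)]
        exact ENNReal.ofReal_le_ofReal (neg_le_neg (Real.log_le_log hε hx2))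
      refine ne_top_of_le_ne_top ?_ hle
      rw [setLIntegral_const]
      exact ENNReal.mul_ne_top ENNReal.ofReal_ne_top (measure_ne_top _ _)
    rw [htop] at h1
    exact ENNReal.add_ne_top.2 ⟨hne, h2⟩ h1
  have hsup : ⨆ n : ℕ, ∫⁻ x in J, min (negLog w x) n ∂circleMeasure = ⊤ := by
    rw [← lintegral_iSup (fun n => hum.min measurable_const)
      (fun m n hmn x => min_le_min_left _ (by exact_mod_cast hmn)), ← hJtop]
    refine lintegral_congr fun x => ?_
    rw [← inf_iSup_eq, ENNReal.iSup_natCast, inf_top_eq]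
  obtain ⟨n, hn⟩ := iSup_eq_top.1 hsup (ENNReal.ofReal (2 * s * c)) ENNReal.ofReal_lt_top
  set v : Circle → ℝ := J.indicator fun x => (min (negLog w x) n).toReal with hv
  have hmin_top : ∀ x, min (negLog w x) (n : ℝ≥0∞) ≠ ⊤ := fun x =>
    ne_top_of_le_ne_top (ENNReal.natCast_ne_top n) (min_le_right _ _)
  have hvm : Measurable v := (hum.min measurable_const).ennreal_toReal.indicator hJm
  have hv0 : ∀ x, 0 ≤ v x := fun x => indicator_nonneg (fun _ _ => ENNReal.toReal_nonneg) x
  have hvn : ∀ x, v x ≤ n := by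
    intro x
    refine indicator_le' (fun x _ => ?_) (fun _ _ => Nat.cast_nonneg n) x
    have := ENNReal.toReal_mono (ENNReal.natCast_ne_top n) (min_le_right (negLog w x) n)
    simpa using this
  -- the truncated integrals have become finite but exceed `2 s c`, so `v` may be scaled down
  have hvI : ∫ x in I, v x ∂circleMeasure = (∫⁻ x in J, min (negLog w x) n ∂circleMeasure).toReal := by
    rw [hv, setIntegral_indicator hJm, ← inter_assoc, inter_self, ← hJ,
      integral_toReal (hum.min measurable_const).aemeasurable
        (Eventually.of_forall fun x => (hmin_top x).lt_top)]
  set K := ∫ x in I, v x ∂circleMeasure with hK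
  have hK1 : 2 * s * c < K := by
    rw [hvI]
    refine (ENNReal.ofReal_lt_iff_lt_toReal (by positivity) ?_).1 hn
    have hle : ∫⁻ x in J, min (negLog w x) n ∂circleMeasure ≤ ∫⁻ x in J, (n : ℝ≥0∞) ∂circleMeasure :=
      lintegral_mono fun x => min_le_right _ _
    refine ne_top_of_le_ne_top ?_ hle
    rw [setLIntegral_const]
    exact ENNReal.mul_ne_top (ENNReal.natCast_ne_top n) (measure_ne_top _ _)
  have hsc : 0 < 2 * s * c := by positivity
  have hK0 : 0 < K := hsc.trans hK1
  refine ⟨fun x => c / K * v x, c / K * n, (hvm.const_mul _).stronglyMeasurable, fun x => ?_, fun x => ?_,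
    fun x hx => ?_, ?_, fun x => ?_⟩
  · have := hv0 x; positivity
  · exact mul_le_mul_of_nonneg_left (hvn x) (by positivity)
  · have : v x ≠ 0 := right_ne_zero_of_mul hx
    have h : x ∈ J := mem_of_indicator_ne_zero this
    exact h
  · rw [integral_const_mul, ← hK, div_mul_cancel₀ _ hK0.ne']
  · by_cases hxJ : x ∈ J
    · rcases (hw0 x).eq_or_lt with hx0 | hx0
      · simp [← hx0]
      have hwx : w x < ε := hxJ.2
      have hlog : 0 ≤ -Real.log (w x) := by
        have := Real.log_nonpos hx0.le (hwx.trans hε1).le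
        linarith
      have hvx : v x ≤ -Real.log (w x) := by
        rw [hv, indicator_of_mem hxJ]
        have := ENNReal.toReal_mono (b := negLog w x) (by rw [negLog_of_pos hx0]; exact ENNReal.ofReal_ne_top)
          (min_le_left (negLog w x) n)
        rwa [negLog_of_pos hx0, ENNReal.toReal_ofReal hlog, ← negLog_of_pos hx0] at this
      have hsK : s * (c / K) ≤ 1 / 2 := by
        rw [mul_div_assoc', div_le_div_iff₀ hK0 two_pos]
        linarith
      have h1 : s * (c / K * v x) ≤ -Real.log (w x) / 2 := by
        calc s * (c / K * v x) = s * (c / K) * v x := by ring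
          _ ≤ 1 / 2 * (-Real.log (w x)) := by
            gcongr
            exact hv0 x
          _ = _ := by ring
      have h2 : Real.exp (-Real.log (w x) / 2) * w x = √(w x) := by
        rw [neg_div, Real.exp_neg, Real.sqrt_eq_rpow, Real.rpow_def_of_pos hx0]
        nth_rewrite 2 [← Real.exp_log hx0]
        rw [← Real.exp_neg, ← Real.exp_add]
        congr 1
        ring
      calc Real.exp (s * (c / K * v x)) * w x ≤ Real.exp (-Real.log (w x) / 2) * w x := by gcongr
        _ = √(w x) := h2
        _ ≤ w x + √(w x) := by linarith
    · have : v x = 0 := indicator_of_notMem hxJ _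
      simp [this, Real.sqrt_nonneg]

instance : NullSingletonClass circleMeasure := by
  constructor
  intro x
  have h : Measurable (Circle.exp : ℝ → Circle) := Circle.exp.continuous.measurable
  rw [circleMeasure, Measure.smul_apply, Measure.map_apply h (measurableSet_singleton x),
    Measure.restrict_apply (h (measurableSet_singleton x))]
  have : (Circle.exp ⁻¹' {x} ∩ Ioc (-Real.pi) Real.pi).Subsingleton := by
    intro a ha b hb
    have hinj := Circle.exp_injOn_Ioc (a := -Real.pi) (b := Real.pi) (by linarith)
    exact hinj ha.2 hb.2 (by rw [show Circle.exp a = x from ha.1, show Circle.exp b = x from hb.1])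
  rw [this.measure_zero, smul_zero]

theorem isOpen_of_isOpenArc {I : Set Circle} (hI : IsOpenArc I) : IsOpen I := by
  obtain ⟨a, b, -, -, rfl⟩ := hI
  exact isLocalHomeomorph_circleExp.isOpenMap _ isOpen_Ioo

theorem measurableSet_residualSet {w : Circle → ℝ} (hw : Measurable w) :
    MeasurableSet (residualSet w) := by
  have h : residualSet w = carrierSet w ∩ (⋃ I ∈ {I | IsOpenArc I ∧ logIntegral w I ≠ ⊥}, I)ᶜ := by
    ext x
    simp only [residualSet, mem_ofPred_eq, mem_inter_iff, mem_compl_iff, mem_iUnion, not_exists]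
    refine and_congr_right fun _ => ⟨fun h I hI hx => hI.2 (h I hI.1 hx), fun h I hI hx => ?_⟩
    by_contra hne
    exact h I ⟨hI, hne⟩ hx
  rw [h]
  refine MeasurableSet.inter (measurableSet_lt measurable_const hw) ?_
  exact (isOpen_biUnion fun I hI => isOpen_of_isOpenArc hI.1).measurableSet.compl

/-- The residual set is relatively closed in the carrier set. -/
theorem exists_dist_residualSet {w : Circle → ℝ} {x : Circle} (hx : x ∈ carrierSet w)
    (hxF : x ∉ residualSet w) : ∃ d > 0, ∀ p ∈ residualSet w, d ≤ ‖(p : ℂ) - x‖ := by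
  have : ∃ I, IsOpenArc I ∧ x ∈ I ∧ logIntegral w I ≠ ⊥ := by
    by_contra hcon
    push Not at hcon
    exact hxF ⟨hx, hcon⟩
  obtain ⟨I, hI, hxI, hne⟩ := this
  obtain ⟨d, hd, hball⟩ := Metric.isOpen_iff.1 (isOpen_of_isOpenArc hI) x hxI
  refine ⟨d, hd, fun p hp => ?_⟩
  by_contra hlt
  refine hne (hp.2 I hI (hball ?_))
  change dist (p : ℂ) x < d
  rw [dist_eq_norm]
  exact not_le.1 hlt

/-- The `j`-th of `N` equal open arcs of the circle, starting at the angle `-π`. -/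
noncomputable def stdArc (N : ℕ) (j : ℕ) : Set Circle :=
  Circle.exp '' Ioo (-Real.pi + 2 * Real.pi * j / N) (-Real.pi + 2 * Real.pi * (j + 1) / N)

theorem stdArc_endpoints {N j : ℕ} (hj : j < N) :
    -Real.pi ≤ -Real.pi + 2 * Real.pi * j / N ∧ -Real.pi + 2 * Real.pi * (j + 1) / N ≤ Real.pi ∧
      -Real.pi + 2 * Real.pi * (j + 1) / N = -Real.pi + 2 * Real.pi * j / N + 2 * Real.pi / N := by
  have hN : (0 : ℝ) < N := by exact_mod_cast (Nat.zero_le j).trans_lt hj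
  have hj' : (j : ℝ) + 1 ≤ N := by exact_mod_cast hj
  have hpi := Real.pi_pos
  refine ⟨?_, ?_, ?_⟩
  · have : 0 ≤ 2 * Real.pi * j / N := by positivity
    linarith
  · have : 2 * Real.pi * (j + 1) / N ≤ 2 * Real.pi := by
      rw [div_le_iff₀ hN]
      gcongr
    linarith
  · field_simp
    ring

theorem isOpenArc_stdArc {N j : ℕ} (hj : j < N) : IsOpenArc (stdArc N j) := by
  have hN : (0 : ℝ) < N := by exact_mod_cast (Nat.zero_le j).trans_lt hj
  obtain ⟨h1, h2, h3⟩ := stdArc_endpoints hj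
  refine ⟨_, _, ?_, ?_, rfl⟩
  · rw [h3]
    have : 0 < 2 * Real.pi / N := by positivity
    linarith
  · linarith

theorem norm_stdArc_sub_le {N j : ℕ} (hj : j < N) {x y : Circle} (hx : x ∈ stdArc N j)
    (hy : y ∈ stdArc N j) : ‖(x : ℂ) - y‖ ≤ 2 * Real.pi / N := by
  obtain ⟨h1, h2, h3⟩ := stdArc_endpoints hj
  obtain ⟨a, ha, rfl⟩ := hx
  obtain ⟨b, hb, rfl⟩ := hy
  have h4 : (Circle.exp a : ℂ) - Circle.exp b
      = Circle.exp b * (Complex.exp (Complex.I * ((a - b : ℝ) : ℂ)) - 1) := by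
    rw [mul_sub, Circle.coe_exp, Circle.coe_exp, ← Complex.exp_add, mul_one]
    congr 2
    push_cast
    ring
  rw [h4, norm_mul, Circle.norm_coe, one_mul]
  refine (Real.norm_exp_I_mul_ofReal_sub_one_le).trans ?_
  rw [Real.norm_eq_abs, abs_le]
  constructor <;> linarith [ha.1, ha.2, hb.1, hb.2]

theorem disjoint_stdArc {N j k : ℕ} (hj : j < N) (hk : k < N) (hjk : j ≠ k) :
    Disjoint (stdArc N j) (stdArc N k) := by
  have hN : (0 : ℝ) < N := by exact_mod_cast (Nat.zero_le j).trans_lt hj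
  obtain ⟨h1, h2, -⟩ := stdArc_endpoints hj
  obtain ⟨h3, h4, -⟩ := stdArc_endpoints hk
  rw [Set.disjoint_left]
  rintro x ⟨a, ha, rfl⟩ ⟨b, hb, hab⟩
  have hab' : b = a := Circle.exp_injOn_Ioc (a := -Real.pi) (b := Real.pi) (by linarith)
    ⟨by linarith [hb.1], by linarith [hb.2]⟩ ⟨by linarith [ha.1], by linarith [ha.2]⟩ hab
  subst hab'
  have hpi := Real.pi_pos
  have key : ∀ i l : ℕ, -Real.pi + 2 * Real.pi * i / N < -Real.pi + 2 * Real.pi * (l + 1) / N → i ≤ l := by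
    intro i l h
    have h5 : 2 * Real.pi * i / N < 2 * Real.pi * (l + 1) / N := by linarith
    rw [div_lt_div_iff_of_pos_right hN] at h5
    have h6 : (i : ℝ) < l + 1 := lt_of_mul_lt_mul_left h5 (by positivity)
    exact Nat.lt_succ_iff.1 (by exact_mod_cast h6)
  exact hjk (le_antisymm (key j k (ha.1.trans hb.2)) (key k j (hb.1.trans ha.2)))

theorem ae_mem_stdArc {N : ℕ} (hN : 0 < N) :
    ∀ᵐ x ∂circleMeasure, ∃ j < N, x ∈ stdArc N j := by
  have hN' : (0 : ℝ) < N := by exact_mod_cast hN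
  have hpi := Real.pi_pos
  -- the endpoints of the arcs form a null set
  have hnull : circleMeasure (range fun j : ℕ => Circle.exp (-Real.pi + 2 * Real.pi * j / N)) = 0 :=
    (countable_range _).measure_zero _
  filter_upwards [measure_eq_zero_iff_ae_notMem.1 hnull] with x hx
  set θ := Complex.arg x with hθ
  have hexp : Circle.exp θ = x := Circle.exp_arg x
  have hθ1 : -Real.pi < θ := Complex.neg_pi_lt_arg _
  have hθ2 : θ ≤ Real.pi := Complex.arg_le_pi _
  set t := (θ + Real.pi) * N / (2 * Real.pi) with ht
  have htθ : θ = -Real.pi + 2 * Real.pi * t / N := by rw [ht]; field_simp; ring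
  have ht0 : 0 ≤ t := by
    have : 0 < θ + Real.pi := by linarith
    positivity
  have htN : t ≤ N := by
    rw [ht, div_le_iff₀ (by positivity), mul_comm]
    gcongr
    linarith
  have hlt : (⌊t⌋₊ : ℝ) < t := by
    refine lt_of_le_of_ne (Nat.floor_le ht0) fun h => hx ⟨⌊t⌋₊, ?_⟩
    beta_reduce
    rw [h, ← htθ, hexp]
  refine ⟨⌊t⌋₊, by exact_mod_cast hlt.trans_le htN, θ, ⟨?_, ?_⟩, hexp⟩
  · rw [htθ]
    gcongr
  · rw [htθ]
    have := Nat.lt_floor_add_one t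
    gcongr

/-- The densities driving the construction: mean zero on short arcs meeting the residual set, equal
to `-A` on most of the residual set, with positive part carried by the set where `w` is small. -/
theorem exists_balanced {w : Circle → ℝ} (hw : Measurable w) (hw0 : ∀ x, 0 ≤ w x)
    (hw_int : Integrable w circleMeasure) {s ε A δ : ℝ} (hs : 0 < s)
    (hε : 0 < ε) (hε1 : ε < 1) (hA : 0 ≤ A) (hδ : 0 < δ) :
    ∃ (ι : Type) (_ : Fintype ι) (I : ι → Set Circle) (B : ℝ) (ψ : Circle → ℝ),
      Balanced I δ A B ψ ∧ (∀ i, ∃ p ∈ I i, p ∈ residualSet w) ∧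
      (∀ x, Real.exp (s * ψ x) * w x ≤ w x + √(w x)) ∧
      ∀ᵐ x ∂circleMeasure, x ∈ residualSet w → ε ≤ w x → ψ x = -A := by
  classical
  have hFm := measurableSet_residualSet hw
  set F := residualSet w with hF
  obtain ⟨N, hNδ⟩ := exists_nat_gt (2 * Real.pi / δ)
  have hN' : (0 : ℝ) < N := lt_trans (by have := Real.pi_pos; positivity) hNδ
  have hN : 0 < N := by exact_mod_cast hN'
  have hδN : 2 * Real.pi / N ≤ δ := by
    rw [div_lt_iff₀ hδ] at hNδ
    rw [div_le_iff₀ hN']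
    linarith
  let ι := {j : Fin N // ∃ p ∈ stdArc N j, p ∈ F}
  let I : ι → Set Circle := fun i => stdArc N i.1
  have hIm : ∀ i, MeasurableSet (I i) := fun i => (isOpen_of_isOpenArc (isOpenArc_stdArc i.1.2)).measurableSet
  have hdisj : Pairwise (Function.onFun Disjoint I) := by
    intro i j hij
    refine disjoint_stdArc i.1.2 j.1.2 fun h => hij (Subtype.ext (Fin.ext h))
  have hbump : ∀ i : ι, _ := fun i => exists_bump hw hw0 (hIm i) (setLIntegral_negLog_eq_top hw_int (by
    obtain ⟨p, hp, hpF⟩ := i.2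
    exact hpF.2 _ (isOpenArc_stdArc i.1.2) hp)) hs hε hε1 (c := A * circleMeasure.real (F ∩ I i))
      (mul_nonneg hA measureReal_nonneg)
  choose p B hpm hp0 hpB hpsupp hpint hpexp using hbump
  let ψ : Circle → ℝ := fun x => ∑ i, (p i x - (F ∩ I i).indicator (fun _ => A) x)
  have hψI : ∀ i, ∀ x ∈ I i, ψ x = p i x - (F ∩ I i).indicator (fun _ => A) x := by
    intro i x hx
    refine Finset.sum_eq_single i (fun j _ hji => ?_) (by simp)
    have hxj : x ∉ I j := Set.disjoint_left.1 (hdisj hji.symm) hx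
    have h1 : p j x = 0 := by
      by_contra h
      exact hxj (hpsupp j x h).1
    rw [h1, indicator_of_notMem (fun h => hxj h.2), sub_zero]
  have hψ0 : ∀ x, x ∉ ⋃ i, I i → ψ x = 0 := by
    intro x hx
    refine Finset.sum_eq_zero fun j _ => ?_
    have hxj : x ∉ I j := fun h => hx (mem_iUnion.2 ⟨j, h⟩)
    have h1 : p j x = 0 := by
      by_contra h
      exact hxj (hpsupp j x h).1
    rw [h1, indicator_of_notMem (fun h => hxj h.2), sub_zero]
  have hB0 : ∀ i, 0 ≤ B i := fun i => (hp0 i 1).trans (hpB i 1)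
  have hind0 : ∀ i x, 0 ≤ (F ∩ I i).indicator (fun _ => A) x := fun i x =>
    indicator_nonneg (fun _ _ => hA) x
  have hindA : ∀ i x, (F ∩ I i).indicator (fun _ => A) x ≤ A := fun i x =>
    indicator_le_self' (fun _ _ => hA) x
  have hpi : ∀ i, Integrable (p i) circleMeasure := fun i =>
    Integrable.of_bound (hpm i).aestronglyMeasurable (B i) (Eventually.of_forall fun x => by
      rw [Real.norm_eq_abs, abs_of_nonneg (hp0 i x)]; exact hpB i x)
  have hAi : ∀ i, Integrable ((F ∩ I i).indicator (fun _ => A)) circleMeasure := fun i =>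
    (integrable_const A).indicator (hFm.inter (hIm i))
  refine ⟨ι, inferInstance, I, ∑ i, (B i + A), ψ, ?_, fun i => i.2, fun x => ?_, ?_⟩
  · refine ⟨hIm, fun i => ?_, hdisj, fun i x hx y hy => ?_, ?_, fun x => ?_, hψ0, fun i => ?_, fun i => ?_⟩
    · obtain ⟨q, hq, -⟩ := i.2
      exact ⟨q, hq⟩
    · exact (norm_stdArc_sub_le i.1.2 hx hy).trans hδN
    · exact Finset.stronglyMeasurable_fun_sum _ fun i _ =>
        (hpm i).sub (stronglyMeasurable_const.indicator (hFm.inter (hIm i)))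
    · refine (Finset.abs_sum_le_sum_abs _ _).trans (Finset.sum_le_sum fun i _ => ?_)
      rw [abs_le]
      constructor <;> linarith [hp0 i x, hpB i x, hind0 i x, hindA i x, hB0 i]
    · rw [setIntegral_congr_fun (hIm i) (hψI i), integral_sub (hpi i).integrableOn (hAi i).integrableOn,
        hpint i, setIntegral_indicator (hFm.inter (hIm i)), setIntegral_const, smul_eq_mul,
        inter_comm F, ← inter_assoc, inter_self, mul_comm, sub_self]
    · have h1 : ∫ x in I i, max (ψ x) 0 ∂circleMeasure ≤ ∫ x in I i, p i x ∂circleMeasure := by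
        refine setIntegral_mono_on ?_ (hpi i).integrableOn (hIm i) fun x hx => ?_
        · have h2 : IntegrableOn (fun x => p i x - (F ∩ I i).indicator (fun _ => A) x) (I i) circleMeasure :=
            ((hpi i).sub (hAi i)).integrableOn
          exact (h2.congr_fun (fun x hx => (hψI i x hx).symm) (hIm i)).pos_part
        · rw [hψI i x hx]
          exact max_le (by linarith [hind0 i x]) (hp0 i x)
      rw [hpint i] at h1
      refine h1.trans ?_
      exact mul_le_mul_of_nonneg_left (measureReal_mono inter_subset_right) hA
  · by_cases hx : x ∈ ⋃ i, I i
    · obtain ⟨i, hi⟩ := mem_iUnion.1 hx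
      refine le_trans ?_ (hpexp i x)
      have : ψ x ≤ p i x := by rw [hψI i x hi]; linarith [hind0 i x]
      have := hw0 x
      gcongr
    · simp [hψ0 x hx, Real.sqrt_nonneg]
  · filter_upwards [ae_mem_stdArc hN] with x hx hxF hxε
    obtain ⟨j, hj, hxj⟩ := hx
    let i : ι := ⟨⟨j, hj⟩, ⟨x, hxj, hxF⟩⟩
    have h1 : p i x = 0 := by
      by_contra h
      exact absurd (hpsupp i x h).2 (not_lt.2 hxε)
    rw [hψI i x hxj, h1, indicator_of_mem (show x ∈ F ∩ I i from ⟨hxF, hxj⟩), zero_sub]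

/-! ### Slowly growing polynomials near zero off the residual set -/

/-- A function holomorphic in a neighbourhood of the closed unit disk is a uniform limit of its Taylor
polynomials there. -/
theorem exists_polynomial_approx {q : ℂ → ℂ} {R : ℝ} (hR : 1 < R)
    (hq : DifferentiableOn ℂ q (Metric.ball 0 R)) {η : ℝ} (hη : 0 < η) :
    ∃ p : ℂ[X], ∀ z : ℂ, ‖z‖ ≤ 1 → ‖p.eval z - q z‖ ≤ η := by
  obtain ⟨R', hR1, hR'⟩ := exists_between hR
  obtain ⟨R'', hR2, hR''⟩ := exists_between hR1
  lift R' to NNReal using by linarith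
  lift R'' to NNReal using by linarith
  have hq' : DifferentiableOn ℂ q (Metric.closedBall 0 R') :=
    hq.mono (Metric.closedBall_subset_ball hR')
  have hps := hq'.hasFPowerSeriesOnBall (by exact_mod_cast zero_lt_one.trans hR1)
  have hu := hps.tendstoUniformlyOn' (r' := R'') (by exact_mod_cast hR'')
  obtain ⟨n, hn⟩ := (Metric.tendstoUniformlyOn_iff.1 hu η hη).exists
  refine ⟨∑ k ∈ Finset.range n, Polynomial.C ((cauchyPowerSeries q 0 R').coeff k) * Polynomial.X ^ k,
    fun z hz => ?_⟩
  have h1 := (hn z (by rw [mem_ball_zero_iff]; linarith)).le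
  rw [dist_comm, dist_eq_norm] at h1
  refine le_trans (le_of_eq ?_) h1
  congr 2
  rw [Polynomial.eval_finsetSum]
  refine Finset.sum_congr rfl fun k _ => ?_
  rw [FormalMultilinearSeries.apply_eq_pow_smul_coeff]
  rw [Polynomial.eval_mul, Polynomial.eval_C, Polynomial.eval_pow, Polynomial.eval_X, sub_zero,
    smul_eq_mul, mul_comm]

variable {ι : Type*} {I : ι → Set Circle} {δ A B : ℝ} {ψ : Circle → ℝ}

/-- The quotient by `z` of one minus the exponential of the (dilated) Herglotz integral of a
balanced density. -/
theorem exists_quotient (h : Balanced I δ A B ψ) {r : ℝ} (hr : r ∈ Ioo (0 : ℝ) 1) :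
    ∃ (R : ℝ) (q : ℂ → ℂ), 1 < R ∧ DifferentiableOn ℂ q (Metric.ball 0 R) ∧
      ∀ z, z * q z = 1 - Complex.exp (r * z * cauchyInt ψ (r * z)) := by
  have hR : 1 < r⁻¹ := (one_lt_inv₀ hr.1).2 hr.2
  set f : ℂ → ℂ := fun z => 1 - Complex.exp (r * z * cauchyInt ψ (r * z)) with hf
  have hmaps : MapsTo (fun z : ℂ => (r : ℂ) * z) (Metric.ball 0 r⁻¹) (Metric.ball 0 1) := by
    intro z hz
    rw [mem_ball_zero_iff] at hz ⊢
    rw [norm_mul, Complex.norm_real, Real.norm_eq_abs, abs_of_pos hr.1]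
    calc r * ‖z‖ < r * r⁻¹ := by have := hr.1; gcongr
      _ = 1 := mul_inv_cancel₀ hr.1.ne'
  have hfd : DifferentiableOn ℂ f (Metric.ball 0 r⁻¹) := by
    have h1 : DifferentiableOn ℂ (fun z : ℂ => cauchyInt ψ (r * z)) (Metric.ball 0 r⁻¹) :=
      (differentiableOn_cauchyInt h.integrable).comp (by fun_prop) hmaps
    have h2 : DifferentiableOn ℂ (fun z : ℂ => (r : ℂ) * z) (Metric.ball 0 r⁻¹) := by fun_prop
    exact (h2.mul h1).cexp.const_sub 1
  refine ⟨r⁻¹, dslope f 0, hR, (Complex.differentiableOn_dslope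
    (Metric.ball_mem_nhds 0 (by linarith))).2 hfd, fun z => ?_⟩
  have := sub_smul_dslope f 0 z
  simpa [hf] using this


/-- One step of the construction. The polynomial `p` is small on compact parts of the disk and on the
parts of the circle away from the residual set, grows slowly towards the circle, and satisfies
`|1 - x p(x)| ≤ a(x) + η` on the circle, where `a ^ s` is close to `exp (s ψ)` in `L¹(ν)`. -/
theorem exists_level {w : Circle → ℝ} (hw : Measurable w) (hw0 : ∀ x, 0 ≤ w x)
    (hw_int : Integrable w circleMeasure) {ν : Measure Circle} [IsFiniteMeasure ν]
    (hν : ν ≪ circleMeasure) {s ε A η : ℝ} (hs : 0 < s)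
    (hε : 0 < ε) (hε1 : ε < 1) (hA : 0 ≤ A) (hη : 0 < η) (hη1 : η ≤ 1 / 2)
    {ε' : ℝ≥0∞} (hε' : 0 < ε') :
    ∃ (p : ℂ[X]) (ψ a : Circle → ℝ),
      (∀ z : ℂ, ‖z‖ < 1 → z ≠ 0 → ‖p.eval z‖ ≤ 5 * Real.exp (η / (1 - ‖z‖))) ∧
      (∀ z : ℂ, ‖z‖ < 1 → z ≠ 0 → η ≤ 1 - ‖z‖ → ‖p.eval z‖ ≤ 3 * η) ∧
      (∀ x : Circle, (∀ y ∈ residualSet w, η ≤ ‖(y : ℂ) - x‖) → ‖p.eval (x : ℂ)‖ ≤ 3 * η) ∧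
      (∀ x : Circle, ‖1 - (x : ℂ) * p.eval (x : ℂ)‖ ≤ a x + η) ∧
      (∀ x, 0 ≤ a x) ∧ Measurable a ∧ Measurable ψ ∧
      ∫⁻ x, ‖a x ^ s - Real.exp (s * ψ x)‖ₑ ∂ν ≤ ε' ∧
      (∀ x, Real.exp (s * ψ x) * w x ≤ w x + √(w x)) ∧
      ∀ᵐ x ∂circleMeasure, x ∈ residualSet w → ε ≤ w x → ψ x = -A := by
  -- this `δ` makes `A δ / d ^ 2 ≤ η / 64` for all distances `d ≥ η`
  set δ : ℝ := η ^ 3 / (64 * (A + 1)) with hδdef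
  have hδ : 0 < δ := by positivity
  have hAδ : 64 * A * δ ≤ η ^ 3 := by
    rw [hδdef, mul_div_assoc', div_le_iff₀ (by positivity)]
    nlinarith [pow_pos hη 3]
  have hη2 : η ^ 2 ≤ η / 2 := by nlinarith
  have hη3 : η ^ 3 ≤ η ^ 2 := by nlinarith [sq_nonneg η]
  have hδη : δ ≤ η / 2 := by
    refine le_trans ?_ (hη3.trans hη2)
    rw [hδdef]
    refine div_le_self (by positivity) ?_
    linarith
  obtain ⟨ι, _, I, B, ψ, h, hIF, hψw, hψF⟩ := exists_balanced hw hw0 hw_int hs hε hε1 hA hδ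
  obtain ⟨r, hr, hrε⟩ := exists_radial_exp_approx h.measurable h.abs_le hs hν hε'
  obtain ⟨R, q, hR, hqd, hq⟩ := exists_quotient h hr
  obtain ⟨p, hp⟩ := exists_polynomial_approx hR hqd hη
  have hrz : ∀ z : ℂ, ‖(r : ℂ) * z‖ = r * ‖z‖ := fun z => by
    rw [norm_mul, Complex.norm_real, Real.norm_eq_abs, abs_of_pos hr.1]
  have hrz_le : ∀ z : ℂ, ‖(r : ℂ) * z‖ ≤ ‖z‖ := fun z => by
    rw [hrz]; nlinarith [norm_nonneg z, hr.2]
  have hpq : ∀ z : ℂ, ‖z‖ ≤ 1 → ‖p.eval z‖ ≤ ‖q z‖ + η := fun z hz => by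
    have h1 := hp z hz
    have h2 := norm_le_norm_add_norm_sub' (p.eval z) (q z)
    linarith
  -- a small value of the Cauchy integral makes the quotient small
  have hqsmall : ∀ z : ℂ, z ≠ 0 → ‖z‖ ≤ 1 → ‖cauchyInt ψ (r * z)‖ ≤ η → ‖q z‖ ≤ 2 * η := by
    intro z hz0 hz1 hc
    have hzpos : 0 < ‖z‖ := norm_pos_iff.2 hz0
    have h1 : ‖(r : ℂ) * z * cauchyInt ψ (r * z)‖ ≤ ‖z‖ * η := by
      rw [norm_mul]
      have := hrz_le z
      gcongr
    have h2 : ‖z * q z‖ ≤ 2 * (‖z‖ * η) := by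
      rw [hq, norm_sub_rev]
      refine (Complex.norm_exp_sub_one_le ?_).trans (by linarith)
      nlinarith
    rw [norm_mul] at h2
    have h3 : ‖z‖ * ‖q z‖ ≤ ‖z‖ * (2 * η) := by linarith
    exact le_of_mul_le_mul_left h3 hzpos
  have hin : ∀ z : ℂ, ‖z‖ < 1 → z ≠ 0 → η ≤ 1 - ‖z‖ → ‖p.eval z‖ ≤ 3 * η := by
    intro z hz hz0 hzη
    have h1 := hrz_le z
    have h2 := h.norm_cauchyInt_le hA hδ.le (z := r * z) (by linarith) (by linarith)
    have h3 : 8 * A * δ / (1 - ‖(r : ℂ) * z‖) ≤ η := by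
      rw [div_le_iff₀ (by linarith)]
      nlinarith
    have := hqsmall z hz0 hz.le (h2.trans h3)
    linarith [hpq z hz.le]
  refine ⟨p, ψ, fun x => Real.exp (poissonInt ψ (r * x)), ?_, hin, ?_, fun x => ?_,
    fun x => (Real.exp_pos _).le, ?_, h.measurable.measurable, ?_, hψw, hψF⟩
  · intro z hz hz0
    have hexp1 : 1 ≤ Real.exp (η / (1 - ‖z‖)) := Real.one_le_exp (div_nonneg hη.le (by linarith))
    rcases le_or_gt (‖z‖) (1 / 2) with hz2 | hz2
    · have := hin z hz hz0 (by linarith)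
      linarith
    · have h1 := hrz_le z
      have h2 := h.re_mul_cauchyInt_le hA hδ.le (by linarith) (z := r * z) (by linarith)
      have h3 : 32 * A * δ / (1 - ‖(r : ℂ) * z‖) ≤ η / (1 - ‖z‖) := by
        have : 32 * A * δ ≤ η := by nlinarith
        have : 0 < 1 - ‖z‖ := by linarith
        gcongr
      have h4 : ‖z * q z‖ ≤ 1 + Real.exp (η / (1 - ‖z‖)) := by
        rw [hq]
        refine (norm_sub_le _ _).trans ?_
        rw [norm_one, Complex.norm_exp]
        gcongr
        exact h2.trans h3
      rw [norm_mul] at h4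
      have h5 : ‖q z‖ ≤ 4 * Real.exp (η / (1 - ‖z‖)) := by nlinarith [norm_nonneg (q z)]
      linarith [hpq z hz.le]
  · intro x hx
    have hxn : ‖(x : ℂ)‖ = 1 := Circle.norm_coe x
    have h1 : ‖cauchyInt ψ (r * x)‖ ≤ 4 * A * δ / (η / 4) ^ 2 := by
      refine h.norm_cauchyInt_le_of_far hA hδ.le (norm_radial_lt hr x) (by positivity) fun i y hy => ?_
      obtain ⟨b, hbI, hbF⟩ := hIF i
      have h2 := hx b hbF
      have h3 := h.diam_le i b hbI y hy
      have h4 := norm_sub_le_norm_sub_add_norm_sub (b : ℂ) y x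
      have h5 := (one_sub_norm_pos_and_le y (norm_radial_lt hr x)).2
      rw [norm_radial hr] at h5
      have h6 : ‖(r : ℂ) * x - x‖ = 1 - r := by
        rw [← sub_one_mul, norm_mul, hxn, mul_one,
          show (r : ℂ) - 1 = ((r - 1 : ℝ) : ℂ) by push_cast; ring, Complex.norm_real,
          Real.norm_eq_abs, abs_of_neg (by linarith [hr.2])]
        ring
      have h7 := norm_sub_le_norm_sub_add_norm_sub (y : ℂ) (r * x) x
      linarith
    have h2 : 4 * A * δ / (η / 4) ^ 2 ≤ η := by
      rw [div_le_iff₀ (by positivity)]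
      nlinarith
    have := hqsmall x (by rw [← norm_pos_iff, hxn]; exact one_pos) hxn.le (h1.trans h2)
    linarith [hpq x hxn.le]
  · have hxn : ‖(x : ℂ)‖ = 1 := Circle.norm_coe x
    have h1 : 1 - (x : ℂ) * p.eval (x : ℂ)
        = Complex.exp (r * x * cauchyInt ψ (r * x)) - x * (p.eval (x : ℂ) - q x) := by
      linear_combination -(hq x)
    rw [h1]
    refine (norm_sub_le _ _).trans ?_
    rw [Complex.norm_exp, re_mul_cauchyInt h.integrable h.integral_eq_zero (norm_radial_lt hr x),
      norm_mul, hxn, one_mul]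
    gcongr
    exact hp x hxn.le
  · exact (stronglyMeasurable_poissonInt_radial hr h.measurable).measurable.exp
  · refine le_trans (le_of_eq (lintegral_congr fun x => ?_)) hrε
    rw [← Real.exp_mul, mul_comm]

/-! ### The measure `μ` and the decay of `G` -/

/-- The decay condition in explicit form: `G x ≤ exp (-c / x)` for small `x`. -/
theorem ExpDec.exists_le {G : ℝ → ℝ} (h : ExpDec G) :
    ∃ c > 0, ∃ x₀ > 0, ∀ x, 0 < x → x < x₀ → G x * Real.exp (c / x) ≤ 1 := by
  obtain ⟨c, hc0, hc⟩ := EReal.lt_iff_exists_real_btwn.1 h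
  have hc0' : 0 < c := by exact_mod_cast hc0
  have hev := eventually_lt_of_lt_liminf hc
  obtain ⟨x₀, hx₀, hsub⟩ := mem_nhdsGT_iff_exists_Ioo_subset.1 hev
  refine ⟨c, hc0', x₀, hx₀, fun x hx hxx => ?_⟩
  have h1 : (c : EReal) < x * ENNReal.log (1 / ENNReal.ofReal (G x)) := hsub ⟨hx, hxx⟩
  rcases le_or_gt (G x) 0 with hG | hG
  · nlinarith [Real.exp_pos (c / x)]
  · rw [one_div, ENNReal.log_inv, ENNReal.log_ofReal_of_pos hG, ← EReal.coe_neg, ← EReal.coe_mul,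
      EReal.coe_lt_coe_iff] at h1
    have h2 : c / x ≤ -Real.log (G x) := by
      rw [div_le_iff₀ hx]
      linarith
    calc G x * Real.exp (c / x) ≤ G x * Real.exp (-Real.log (G x)) := by gcongr
      _ = 1 := by rw [Real.exp_neg, Real.exp_log hG, mul_inv_cancel₀ hG.ne']

/-- At least exponential decay of `G` makes an exponential of `1 / (1 - |z|)` integrable. -/
theorem exists_lintegral_exp_lt_top {G : ℝ → ℝ}
    (hG_meas : Measurable (fun x : Set.Ioc (0 : ℝ) 1 => G x))
    (hG_fin : muDisk G Set.univ < ∞) (hG_dec : ExpDec G) :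
    ∃ c > 0, ∫⁻ z, ENNReal.ofReal (Real.exp (c / (1 - ‖z‖))) ∂muDisk G < ∞ := by
  obtain ⟨c, hc, x₀, hx₀, hG⟩ := hG_dec.exists_le
  refine ⟨c, hc, ?_⟩
  -- `G` is only measurable on `(0, 1]`, so it is replaced by a measurable extension
  set G' : ℝ → ℝ := Function.extend ((↑) : Ioc (0 : ℝ) 1 → ℝ) (fun x => G x) (fun _ => 0) with hG'
  have hG'm : Measurable G' :=
    (MeasurableEmbedding.subtype_coe measurableSet_Ioc).measurable_extend hG_meas measurable_const
  have hball : ∀ᵐ z ∂diskMeasure, ‖z‖ < 1 := by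
    rw [diskMeasure]
    refine Measure.ae_smul_measure ?_ _
    filter_upwards [ae_restrict_mem Metric.isOpen_ball.measurableSet] with z hz
    simpa using hz
  have hGG' : ∀ᵐ z ∂diskMeasure, ENNReal.ofReal (G (1 - ‖z‖)) = ENNReal.ofReal (G' (1 - ‖z‖)) := by
    filter_upwards [hball] with z hz
    have hmem : 1 - ‖z‖ ∈ Ioc (0 : ℝ) 1 := ⟨by linarith, by linarith [norm_nonneg z]⟩
    rw [hG', Subtype.val_injective.extend_apply (fun x : Ioc (0 : ℝ) 1 => G x) (fun _ => 0) ⟨_, hmem⟩]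
  have hm : Measurable fun z : ℂ => ENNReal.ofReal (G' (1 - ‖z‖)) :=
    (hG'm.comp (measurable_const.sub measurable_norm)).ennreal_ofReal
  have hmu : muDisk G = diskMeasure.withDensity fun z => ENNReal.ofReal (G' (1 - ‖z‖)) :=
    withDensity_congr_ae hGG'
  have hdisk : IsFiniteMeasure diskMeasure := by
    constructor
    rw [diskMeasure, Measure.smul_apply, Measure.restrict_apply_univ, smul_eq_mul]
    refine ENNReal.mul_lt_top ?_ measure_ball_lt_top
    rw [ENNReal.inv_lt_top]
    simp [Real.pi_pos]
  rw [hmu, withDensity_apply _ MeasurableSet.univ, setLIntegral_univ] at hG_fin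
  have hme : Measurable fun z : ℂ => ENNReal.ofReal (Real.exp (c / (1 - ‖z‖))) := by fun_prop
  rw [hmu, lintegral_withDensity_eq_lintegral_mul _ hm hme]
  simp only [Pi.mul_apply]
  have hle : ∫⁻ z : ℂ, ENNReal.ofReal (G' (1 - ‖z‖)) * ENNReal.ofReal (Real.exp (c / (1 - ‖z‖)))
        ∂diskMeasure
      ≤ ∫⁻ z : ℂ, 1 + ENNReal.ofReal (G' (1 - ‖z‖)) * ENNReal.ofReal (Real.exp (c / x₀)) ∂diskMeasure := by
    refine lintegral_mono_ae ?_
    filter_upwards [hball, hGG'] with z hz hzG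
    rw [← hzG]
    rcases lt_or_ge (1 - ‖z‖) x₀ with hx | hx
    · refine le_add_right ?_
      rw [← ENNReal.ofReal_mul' (Real.exp_pos _).le, ENNReal.ofReal_le_one]
      exact hG _ (by linarith) hx
    · refine le_add_left ?_
      gcongr
  refine hle.trans_lt ?_
  rw [lintegral_add_left measurable_const, lintegral_mul_const _ hm, lintegral_const, one_mul]
  exact ENNReal.add_lt_top.2 ⟨measure_lt_top _ _, ENNReal.mul_lt_top hG_fin ENNReal.ofReal_lt_top⟩

theorem ae_muDisk (G : ℝ → ℝ) : ∀ᵐ z ∂muDisk G, ‖z‖ < 1 ∧ z ≠ 0 := by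
  have h1 : ∀ᵐ z ∂diskMeasure, ‖z‖ < 1 ∧ z ≠ 0 := by
    rw [diskMeasure]
    refine Measure.ae_smul_measure ?_ _
    have h0 : ∀ᵐ z : ℂ ∂volume, z ≠ 0 := by
      simpa using measure_eq_zero_iff_ae_notMem.1 (measure_singleton (μ := volume) (0 : ℂ))
    filter_upwards [ae_restrict_mem Metric.isOpen_ball.measurableSet, ae_restrict_of_ae h0] with z hz hz0
    exact ⟨by simpa using hz, hz0⟩
  exact (withDensity_absolutelyContinuous _ _).ae_le h1

/-- The weighted arclength measure `w dm`, on the circle itself. -/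
noncomputable def nuCircle (w : Circle → ℝ) : Measure Circle :=
  circleMeasure.withDensity fun x => ENNReal.ofReal (w x)

theorem nuCircle_ac (w : Circle → ℝ) : nuCircle w ≪ circleMeasure :=
  withDensity_absolutelyContinuous _ _

theorem isFiniteMeasure_nuCircle {w : Circle → ℝ} (hw_int : Integrable w circleMeasure) :
    IsFiniteMeasure (nuCircle w) := by
  constructor
  rw [nuCircle, withDensity_apply _ MeasurableSet.univ, setLIntegral_univ]
  refine lt_of_le_of_lt (lintegral_mono fun x => ?_) hw_int.2
  rw [Real.enorm_eq_ofReal_abs]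
  exact ENNReal.ofReal_le_ofReal (le_abs_self _)

theorem ae_nuCircle_pos {w : Circle → ℝ} (hw : Measurable w) : ∀ᵐ x ∂nuCircle w, 0 < w x := by
  rw [nuCircle, ae_withDensity_iff hw.ennreal_ofReal]
  refine Eventually.of_forall fun x hx => ?_
  by_contra h
  exact hx (ENNReal.ofReal_of_nonpos (not_lt.1 h))

theorem measurableEmbedding_coe : MeasurableEmbedding (fun x : Circle => (x : ℂ)) := by
  have h : Continuous fun x : Circle => (x : ℂ) := by fun_prop
  exact (h.isClosedEmbedding fun x y hxy => Circle.ext hxy).measurableEmbedding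

theorem isFiniteMeasure_mu {G : ℝ → ℝ} (hG_fin : muDisk G Set.univ < ∞) {w : Circle → ℝ}
    (hw_int : Integrable w circleMeasure) : IsFiniteMeasure (mu G w) := by
  have h1 : IsFiniteMeasure (muDisk G) := ⟨hG_fin⟩
  have h2 := isFiniteMeasure_nuCircle hw_int
  have h3 : IsFiniteMeasure (muCircle w) :=
    inferInstanceAs (IsFiniteMeasure (Measure.map _ (nuCircle w)))
  exact inferInstanceAs (IsFiniteMeasure (muDisk G + muCircle w))

theorem ae_mu_iff {G : ℝ → ℝ} {w : Circle → ℝ} {P : ℂ → Prop} :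
    (∀ᵐ z ∂mu G w, P z) ↔ (∀ᵐ z ∂muDisk G, P z) ∧ ∀ᵐ x : Circle ∂nuCircle w, P (x : ℂ) := by
  rw [mu, ae_add_measure_iff, muCircle, measurableEmbedding_coe.ae_map_iff]
  rfl

theorem lintegral_mu (G : ℝ → ℝ) (w : Circle → ℝ) (f : ℂ → ℝ≥0∞) :
    ∫⁻ z, f z ∂mu G w = ∫⁻ z, f z ∂muDisk G + ∫⁻ x : Circle, f x ∂nuCircle w := by
  rw [mu, lintegral_add_measure, muCircle, measurableEmbedding_coe.lintegral_map, nuCircle]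

theorem ae_mu_norm_le (G : ℝ → ℝ) (w : Circle → ℝ) : ∀ᵐ z ∂mu G w, ‖z‖ ≤ 1 :=
  ae_mu_iff.2 ⟨(ae_muDisk G).mono fun _ hz => hz.1.le,
    Eventually.of_forall fun x => (Circle.norm_coe x).le⟩

/-! ### A dominated sequence of polynomials -/

theorem iSup_rpow_le {f : ℕ → ℝ≥0∞} {s : ℝ} (hs : 0 < s) {b : ℝ≥0∞} (h : ∀ n, f n ^ s ≤ b) :
    (⨆ n, f n) ^ s ≤ b := by
  rw [← ENNReal.le_rpow_inv_iff hs]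
  exact iSup_le fun n => (ENNReal.le_rpow_inv_iff hs).2 (h n)

theorem lintegral_inv_sqrt_lt_top {w : Circle → ℝ} (hw : Measurable w) (hw0 : ∀ x, 0 ≤ w x)
    (hw_int : Integrable w circleMeasure) :
    ∫⁻ x, ENNReal.ofReal (√(w x))⁻¹ ∂nuCircle w < ∞ := by
  have hm : Measurable fun x => ENNReal.ofReal (√(w x))⁻¹ := hw.sqrt.inv.ennreal_ofReal
  rw [nuCircle, lintegral_withDensity_eq_lintegral_mul _ hw.ennreal_ofReal hm]
  have hle : ∀ x, ((fun x => ENNReal.ofReal (w x)) * fun x => ENNReal.ofReal (√(w x))⁻¹ : Circle → ℝ≥0∞) x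
      ≤ ENNReal.ofReal (1 + w x) := by
    intro x
    rw [Pi.mul_apply, ← ENNReal.ofReal_mul (hw0 x)]
    refine ENNReal.ofReal_le_ofReal ?_
    rw [← div_eq_mul_inv, Real.div_sqrt]
    nlinarith [Real.sq_sqrt (hw0 x), sq_nonneg (√(w x) - 1), Real.sqrt_nonneg (w x)]
  refine (lintegral_mono hle).trans_lt ?_
  have h1 : Integrable (fun x => 1 + w x) circleMeasure := (integrable_const 1).add hw_int
  exact h1.lintegral_lt_top

/-- Polynomials converging `μ`-almost everywhere to `z̄` on the residual set and to `0` elsewhere, with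
a maximal function in `L^s(μ)`. -/
theorem exists_polynomial_seq {G : ℝ → ℝ}
    (hG_meas : Measurable (fun x : Set.Ioc (0 : ℝ) 1 => G x))
    (hG_fin : muDisk G Set.univ < ∞) (hG_dec : ExpDec G)
    {w : Circle → ℝ} (hw : Measurable w) (hw0 : ∀ x, 0 ≤ w x) (hw_int : Integrable w circleMeasure)
    {s : ℝ} (hs : 0 < s) :
    ∃ p : ℕ → ℂ[X],
      (∀ᵐ z ∂mu G w, Tendsto (fun n => (p n).eval z) atTop
        (𝓝 (((fun x : Circle => (x : ℂ)) '' residualSet w).indicator (starRingEnd ℂ) z))) ∧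
      ∫⁻ z, (⨆ n, ‖(p n).eval z‖ₑ) ^ s ∂mu G w < ∞ := by
  obtain ⟨c, hc, hcint⟩ := exists_lintegral_exp_lt_top hG_meas hG_fin hG_dec
  have := isFiniteMeasure_nuCircle hw_int
  obtain ⟨ε', hε', hsum⟩ := ENNReal.exists_pos_sum_of_countable' (one_ne_zero (α := ℝ≥0∞)) ℕ
  -- growth `exp (η / (1 - |z|))` with `η ≤ c / s` has an integrable `s`-th power
  set κ : ℝ := min 1 (c / s) with hκ
  have hκ0 : 0 < κ := lt_min one_pos (by positivity)
  set η : ℕ → ℝ := fun n => κ / (n + 2) with hη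
  have hη0 : ∀ n, 0 < η n := fun n => by positivity
  have hηκ : ∀ n, η n ≤ κ / 2 := fun n => by
    simp only [hη]
    gcongr
    linarith [(Nat.cast_nonneg n : (0 : ℝ) ≤ n)]
  have hη1 : ∀ n, η n ≤ 1 / 2 := fun n => (hηκ n).trans (by linarith [min_le_left 1 (c / s)])
  have hηc : ∀ n, η n ≤ c / s := fun n => (hηκ n).trans (by linarith [min_le_right 1 (c / s)])
  have hinv : Tendsto (fun n : ℕ => 1 / ((n : ℝ) + 2)) atTop (𝓝 0) := by
    have := tendsto_const_nhds.div_atTop (a := (1 : ℝ))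
      (tendsto_atTop_add_const_right atTop (2 : ℝ) tendsto_natCast_atTop_atTop)
    simpa using this
  have hηlim : Tendsto η atTop (𝓝 0) := by
    have := hinv.const_mul κ
    simp only [mul_zero, mul_one_div] at this
    exact this
  have hlev := fun n : ℕ => exists_level hw hw0 hw_int (nuCircle_ac w) hs (ε := 1 / ((n : ℝ) + 2))
    (A := n) (by positivity) (by
      rw [div_lt_one (by positivity)]
      linarith [(Nat.cast_nonneg n : (0 : ℝ) ≤ n)]) (Nat.cast_nonneg n) (hη0 n) (hη1 n) (hε' n)
  choose p ψ a hgrow hin hfar hcirc ha0 ham hψm hD hψw hψF using hlev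
  set D : ℕ → Circle → ℝ≥0∞ := fun n x => ‖a n x ^ s - Real.exp (s * ψ n x)‖ₑ with hDdef
  have hDm : ∀ n, Measurable (D n) := fun n =>
    (((ham n).pow_const s).sub ((hψm n).const_mul s).exp).enorm
  have hDsum : ∫⁻ x, ∑' n, D n x ∂nuCircle w ≠ ∞ := by
    rw [lintegral_tsum fun n => (hDm n).aemeasurable]
    exact ((ENNReal.tsum_le_tsum hD).trans_lt (hsum.trans ENNReal.one_lt_top)).ne
  have hsmall : ∀ {z : ℂ}, (∀ᶠ n in atTop, ‖(p n).eval z‖ ≤ 3 * η n) →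
      Tendsto (fun n => (p n).eval z) atTop (𝓝 0) := fun h => by
    refine squeeze_zero_norm' h ?_
    simpa using hηlim.const_mul 3
  refine ⟨p, ae_mu_iff.2 ⟨?_, ?_⟩, ?_⟩
  · -- inside the disk
    filter_upwards [ae_muDisk G] with z hz
    have hzF : z ∉ (fun x : Circle => (x : ℂ)) '' residualSet w := by
      rintro ⟨x, -, rfl⟩
      exact absurd (Circle.norm_coe x) hz.1.ne
    rw [indicator_of_notMem hzF]
    refine hsmall ?_
    have h1z : 0 < 1 - ‖z‖ := by linarith [hz.1]
    filter_upwards [hηlim.eventually (gt_mem_nhds h1z)] with n hn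
    exact hin n z hz.1 hz.2 hn.le
  · -- on the circle
    filter_upwards [ae_nuCircle_pos hw, ae_lt_top (Measurable.tsum hDm) hDsum,
      (nuCircle_ac w).ae_le (ae_all_iff.2 hψF)] with x hwx hDx hψx
    have hxn : ‖(x : ℂ)‖ = 1 := Circle.norm_coe x
    by_cases hxF : x ∈ residualSet w
    · rw [indicator_of_mem (mem_image_of_mem _ hxF)]
      have hD0 : Tendsto (fun n => a n x ^ s - Real.exp (s * ψ n x)) atTop (𝓝 0) := by
        rw [tendsto_zero_iff_norm_tendsto_zero]
        have := (ENNReal.tendsto_toReal ENNReal.zero_ne_top).comp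
          (ENNReal.tendsto_atTop_zero_of_tsum_ne_top hDx.ne)
        simpa [hDdef, Function.comp_def] using this
      have hψ0 : Tendsto (fun n => Real.exp (s * ψ n x)) atTop (𝓝 0) := by
        have h1 : Tendsto (fun n : ℕ => Real.exp (-(s * n))) atTop (𝓝 0) :=
          Real.tendsto_exp_neg_atTop_nhds_zero.comp
            (tendsto_natCast_atTop_atTop.const_mul_atTop hs)
        refine h1.congr' ?_
        filter_upwards [hinv.eventually (gt_mem_nhds hwx)] with n hn
        rw [hψx n hxF hn.le, mul_neg]
      have has : Tendsto (fun n => a n x ^ s) atTop (𝓝 0) := by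
        have := hD0.add hψ0
        simpa using this
      have ha : Tendsto (fun n => a n x) atTop (𝓝 0) := by
        have h1 := has.rpow_const (p := s⁻¹) (Or.inr (inv_nonneg.2 hs.le))
        rw [Real.zero_rpow (inv_ne_zero hs.ne')] at h1
        refine h1.congr fun n => ?_
        rw [← Real.rpow_mul (ha0 n x), mul_inv_cancel₀ hs.ne', Real.rpow_one]
      have hone : Tendsto (fun n => 1 - (x : ℂ) * (p n).eval (x : ℂ)) atTop (𝓝 0) := by
        refine squeeze_zero_norm (fun n => hcirc n x) ?_
        simpa using ha.add hηlim
      have hxx : (starRingEnd ℂ) (x : ℂ) * x = 1 := by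
        rw [mul_comm, Complex.mul_conj, Complex.normSq_eq_norm_sq, hxn]
        simp
      have h2 := (hone.const_sub 1).const_mul ((starRingEnd ℂ) (x : ℂ))
      simp only [sub_sub_cancel, sub_zero, mul_one, ← mul_assoc, hxx, one_mul] at h2
      exact h2
    · have hxF' : (x : ℂ) ∉ (fun x : Circle => (x : ℂ)) '' residualSet w := by
        rintro ⟨y, hy, hyx⟩
        exact hxF (Circle.ext hyx ▸ hy)
      rw [indicator_of_notMem hxF']
      obtain ⟨d, hd, hdist⟩ := exists_dist_residualSet (show x ∈ carrierSet w from hwx) hxF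
      refine hsmall ?_
      filter_upwards [hηlim.eventually (gt_mem_nhds hd)] with n hn
      exact hfar n x fun y hy => hn.le.trans (hdist y hy)
  · rw [lintegral_mu]
    refine ENNReal.add_lt_top.2 ⟨?_, ?_⟩
    · have hle : ∫⁻ z, (⨆ n, ‖(p n).eval z‖ₑ) ^ s ∂muDisk G
          ≤ ∫⁻ z, ENNReal.ofReal (5 ^ s) * ENNReal.ofReal (Real.exp (c / (1 - ‖z‖))) ∂muDisk G := by
        refine lintegral_mono_ae ?_
        filter_upwards [ae_muDisk G] with z hz
        refine iSup_rpow_le hs fun n => ?_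
        have h1z : 0 < 1 - ‖z‖ := by linarith [hz.1]
        have h1 : ‖(p n).eval z‖ ≤ 5 * Real.exp (c / s / (1 - ‖z‖)) := by
          refine (hgrow n z hz.1 hz.2).trans ?_
          have := hηc n
          gcongr
        rw [← ofReal_norm, ENNReal.ofReal_rpow_of_nonneg (norm_nonneg _) hs.le,
          ← ENNReal.ofReal_mul (by positivity)]
        refine ENNReal.ofReal_le_ofReal ((Real.rpow_le_rpow (norm_nonneg _) h1 hs.le).trans ?_)
        rw [Real.mul_rpow (by norm_num) (Real.exp_pos _).le, ← Real.exp_mul]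
        apply le_of_eq
        congr 2
        field_simp
      refine hle.trans_lt ?_
      rw [lintegral_const_mul _ (by fun_prop)]
      exact ENNReal.mul_lt_top ENNReal.ofReal_lt_top hcint
    · have hle : ∫⁻ x : Circle, (⨆ n, ‖(p n).eval (x : ℂ)‖ₑ) ^ s ∂nuCircle w
          ≤ ∫⁻ x, ENNReal.ofReal (4 ^ s) * (2 + ENNReal.ofReal (√(w x))⁻¹ + ∑' n, D n x)
            ∂nuCircle w := by
        refine lintegral_mono_ae ?_
        filter_upwards [ae_nuCircle_pos hw] with x hwx
        refine iSup_rpow_le hs fun n => ?_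
        have hxn : ‖(x : ℂ)‖ = 1 := Circle.norm_coe x
        have h1 : ‖(p n).eval (x : ℂ)‖ ≤ 2 + a n x := by
          have h2 : ‖(p n).eval (x : ℂ)‖ = ‖1 - (1 - (x : ℂ) * (p n).eval (x : ℂ))‖ := by
            rw [sub_sub_cancel, norm_mul, hxn, one_mul]
          have h3 := norm_sub_le (1 : ℂ) (1 - (x : ℂ) * (p n).eval (x : ℂ))
          rw [norm_one] at h3
          linarith [hcirc n x, hη1 n]
        have h4 : ‖(p n).eval (x : ℂ)‖ ^ s ≤ 4 ^ s * (1 + a n x ^ s) := by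
          have ha := ha0 n x
          have h5 : 2 + a n x ≤ 4 * max 1 (a n x) := by
            linarith [le_max_left 1 (a n x), le_max_right 1 (a n x)]
          refine (Real.rpow_le_rpow (norm_nonneg _) (h1.trans h5) hs.le).trans ?_
          rw [Real.mul_rpow (by norm_num) (by positivity)]
          gcongr
          have := Real.rpow_nonneg ha s
          rcases le_total 1 (a n x) with h | h
          · rw [max_eq_right h]; linarith
          · rw [max_eq_left h, Real.one_rpow]; linarith
        have h6 : Real.exp (s * ψ n x) ≤ 1 + (√(w x))⁻¹ := by
          have h7 := hψw n x
          have h8 : w x + √(w x) = (1 + (√(w x))⁻¹) * w x := by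
            have := Real.mul_self_sqrt hwx.le
            have : 0 < √(w x) := Real.sqrt_pos.2 hwx
            field_simp
            nlinarith
          rw [h8] at h7
          exact le_of_mul_le_mul_right h7 hwx
        have h9 : 1 + a n x ^ s ≤ 2 + (√(w x))⁻¹ + ‖a n x ^ s - Real.exp (s * ψ n x)‖ := by
          have := le_abs_self (a n x ^ s - Real.exp (s * ψ n x))
          rw [Real.norm_eq_abs]
          linarith
        rw [← ofReal_norm, ENNReal.ofReal_rpow_of_nonneg (norm_nonneg _) hs.le]
        calc ENNReal.ofReal (‖(p n).eval (x : ℂ)‖ ^ s)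
            ≤ ENNReal.ofReal (4 ^ s * (2 + (√(w x))⁻¹ + ‖a n x ^ s - Real.exp (s * ψ n x)‖)) := by
              refine ENNReal.ofReal_le_ofReal (h4.trans ?_)
              gcongr
          _ = ENNReal.ofReal (4 ^ s) * (2 + ENNReal.ofReal (√(w x))⁻¹ + D n x) := by
              rw [ENNReal.ofReal_mul (by positivity), ENNReal.ofReal_add (by positivity) (by positivity),
                ENNReal.ofReal_add (by positivity) (by positivity), ofReal_norm,
                ENNReal.ofReal_ofNat]
          _ ≤ _ := by
              gcongr
              exact ENNReal.le_tsum n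
      refine hle.trans_lt ?_
      have hm : Measurable fun x => 2 + ENNReal.ofReal (√(w x))⁻¹ :=
        measurable_const.add hw.sqrt.inv.ennreal_ofReal
      rw [lintegral_const_mul' _ _ ENNReal.ofReal_ne_top, lintegral_add_left hm,
        lintegral_add_left measurable_const, lintegral_const]
      refine ENNReal.mul_lt_top ENNReal.ofReal_lt_top (ENNReal.add_lt_top.2
        ⟨ENNReal.add_lt_top.2 ⟨ENNReal.mul_lt_top (by norm_num) (measure_lt_top _ _), ?_⟩, hDsum.lt_top⟩)
      exact lintegral_inv_sqrt_lt_top hw hw0 hw_int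

/-! ### Approximation in `L^t(μ)` -/

/-- The functions approximable by polynomials in `L^t(μ)`, as a space of functions rather than of
classes. -/
def approxSubmodule (t : ℝ≥0∞) (μ : Measure ℂ) : Submodule ℂ (ℂ → ℂ) where
  carrier := {f | AEStronglyMeasurable f μ ∧
    ∀ ε : ℝ≥0∞, 0 < ε → ∃ p : ℂ[X], eLpNorm (fun z => f z - p.eval z) t μ < ε}
  zero_mem' := ⟨aestronglyMeasurable_const, fun ε hε => ⟨0, by simpa using hε⟩⟩
  add_mem' := by
    rintro f g ⟨hf, hf'⟩ ⟨hg, hg'⟩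
    refine ⟨hf.add hg, fun ε hε => ?_⟩
    obtain ⟨η, hη, h⟩ := exists_Lp_half ℂ μ t hε.ne'
    obtain ⟨p, hp⟩ := hf' η hη
    obtain ⟨q, hq⟩ := hg' η hη
    refine ⟨p + q, ?_⟩
    have := h _ _ (hf.sub p.continuous.aestronglyMeasurable)
      (hg.sub q.continuous.aestronglyMeasurable) hp.le hq.le
    convert this using 2
    ext z
    simp
    ring
  smul_mem' := by
    rintro c f ⟨hf, hf'⟩
    refine ⟨hf.const_smul c, fun ε hε => ?_⟩
    rcases eq_or_ne c 0 with rfl | hc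
    · exact ⟨0, by simpa using hε⟩
    have hc' : ‖c‖ₑ ≠ 0 := by simpa using hc
    obtain ⟨p, hp⟩ := hf' (ε / ‖c‖ₑ) (ENNReal.div_pos hε.ne' enorm_ne_top)
    refine ⟨c • p, ?_⟩
    have h1 : (fun z => (c • f) z - (c • p).eval z) = c • fun z => f z - p.eval z := by
      ext z
      simp [mul_sub]
    rw [h1, eLpNorm_const_smul]
    exact ENNReal.mul_lt_of_lt_div' hp

theorem mem_approxSubmodule_of_forall {t : ℝ≥0∞} {μ : Measure ℂ} {f : ℂ → ℂ}
    (hf : AEStronglyMeasurable f μ)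
    (h : ∀ ε : ℝ≥0∞, ε ≠ 0 → ∃ g ∈ approxSubmodule t μ, eLpNorm (f - g) t μ ≤ ε) :
    f ∈ approxSubmodule t μ := by
  refine ⟨hf, fun ε hε => ?_⟩
  obtain ⟨η, hη, hhalf⟩ := exists_Lp_half ℂ μ t hε.ne'
  obtain ⟨g, ⟨hg, hg'⟩, hfg⟩ := h η hη.ne'
  obtain ⟨p, hp⟩ := hg' η hη
  refine ⟨p, ?_⟩
  have := hhalf _ _ (hf.sub hg) (hg.sub p.continuous.aestronglyMeasurable) hfg hp.le
  convert this using 2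
  ext z
  simp

/-- Dominated convergence of a sequence of polynomials. -/
theorem mem_approxSubmodule_of_tendsto {t : ℝ≥0∞} (ht : t ≠ 0) (ht' : t ≠ ∞) {μ : Measure ℂ}
    {P : ℕ → ℂ[X]} {g : ℂ → ℂ} (hlim : ∀ᵐ z ∂μ, Tendsto (fun n => (P n).eval z) atTop (𝓝 (g z)))
    {M : ℂ → ℝ≥0∞} (hM : ∀ᵐ z ∂μ, ∀ n, ‖(P n).eval z‖ₑ ≤ M z)
    (hMint : ∫⁻ z, M z ^ t.toReal ∂μ < ∞) : g ∈ approxSubmodule t μ := by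
  have htpos : 0 < t.toReal := ENNReal.toReal_pos ht ht'
  have hPm : ∀ n, AEStronglyMeasurable (fun z => (P n).eval z) μ := fun n =>
    (P n).continuous.aestronglyMeasurable
  have hg : AEStronglyMeasurable g μ := aestronglyMeasurable_of_tendsto_ae atTop hPm hlim
  refine ⟨hg, fun ε hε => ?_⟩
  have key := tendsto_lintegral_of_dominated_convergence' (μ := μ)
    (F := fun n z => ‖g z - (P n).eval z‖ₑ ^ t.toReal) (f := fun _ => 0)
    (fun z => 2 ^ t.toReal * M z ^ t.toReal)
    (fun n => ((hg.sub (hPm n)).enorm.pow_const _)) ?_ ?_ ?_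
  · rw [lintegral_zero] at key
    have h2 := key.ennrpow_const (1 / t.toReal)
    rw [ENNReal.zero_rpow_of_pos (by positivity)] at h2
    obtain ⟨n, hn⟩ := (h2.eventually (gt_mem_nhds hε)).exists
    exact ⟨P n, by rwa [eLpNorm_eq_lintegral_rpow_enorm_toReal ht ht']⟩
  · intro n
    filter_upwards [hM, hlim] with z hz hl
    rw [← ENNReal.mul_rpow_of_nonneg _ _ htpos.le]
    gcongr
    have h1 : ‖g z‖ₑ ≤ M z := le_of_tendsto hl.enorm (Eventually.of_forall hz)
    calc ‖g z - (P n).eval z‖ₑ ≤ ‖g z‖ₑ + ‖(P n).eval z‖ₑ := enorm_sub_le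
      _ ≤ M z + M z := add_le_add h1 (hz n)
      _ = 2 * M z := (two_mul _).symm
  · rw [lintegral_const_mul' _ _ (by finiteness)]
    exact (ENNReal.mul_lt_top (by finiteness) hMint).ne
  · filter_upwards [hlim] with z hl
    have h1 : Tendsto (fun n => ‖g z - (P n).eval z‖ₑ) atTop (𝓝 0) := by
      have := (hl.const_sub (g z)).enorm
      simpa using this
    have h2 := h1.ennrpow_const t.toReal
    rwa [ENNReal.zero_rpow_of_pos htpos] at h2

/-- With `z̄` approximated on the residual set, `z ^ (k + 1) z̄ = z ^ k` is approximated there too. -/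
theorem indicator_pow_mem
    {G : ℝ → ℝ} (hG_meas : Measurable (fun x : Set.Ioc (0 : ℝ) 1 => G x))
    (hG_fin : muDisk G Set.univ < ∞) (hG_dec : ExpDec G)
    {w : Circle → ℝ} (hw : Measurable w) (hw0 : ∀ x, 0 ≤ w x) (hw_int : Integrable w circleMeasure)
    {t : ℝ≥0∞} (ht : t ≠ 0) (ht' : t ≠ ∞) (k : ℕ) :
    ((fun x : Circle => (x : ℂ)) '' residualSet w).indicator (fun z => z ^ k)
      ∈ approxSubmodule t (mu G w) := by
  obtain ⟨p, hlim, hM⟩ := exists_polynomial_seq hG_meas hG_fin hG_dec hw hw0 hw_int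
    (ENNReal.toReal_pos ht ht')
  refine mem_approxSubmodule_of_tendsto ht ht' (P := fun n => Polynomial.X ^ (k + 1) * p n)
    (M := fun z => ⨆ n, ‖(p n).eval z‖ₑ) ?_ ?_ hM
  · filter_upwards [hlim] with z hz
    have h1 := hz.const_mul (z ^ (k + 1))
    simp only [Polynomial.eval_mul, Polynomial.eval_pow, Polynomial.eval_X]
    convert h1 using 2
    by_cases hzF : z ∈ (fun x : Circle => (x : ℂ)) '' residualSet w
    · rw [indicator_of_mem hzF, indicator_of_mem hzF]
      obtain ⟨x, -, rfl⟩ := hzF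
      rw [pow_succ, mul_assoc, Complex.mul_conj, Complex.normSq_eq_norm_sq, Circle.norm_coe]
      simp
    · rw [indicator_of_notMem hzF, indicator_of_notMem hzF, mul_zero]
  · filter_upwards [ae_mu_norm_le G w] with z hz n
    simp only [Polynomial.eval_mul, Polynomial.eval_pow, Polynomial.eval_X, enorm_mul, enorm_pow]
    have h1 : ‖z‖ₑ ≤ 1 := by
      rw [← ofReal_norm, ENNReal.ofReal_le_one]
      exact hz
    calc ‖z‖ₑ ^ (k + 1) * ‖(p n).eval z‖ₑ ≤ 1 * ‖(p n).eval z‖ₑ := by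
          gcongr
          exact pow_le_one₀ zero_le h1
      _ ≤ _ := by rw [one_mul]; exact le_iSup (fun n => ‖(p n).eval z‖ₑ) n

/-- Powers of the approximants of `z̄` converge in `L^t(μ)` because these are dominated in
`L^(kt)(μ)`. -/
theorem indicator_conj_pow_mem
    {G : ℝ → ℝ} (hG_meas : Measurable (fun x : Set.Ioc (0 : ℝ) 1 => G x))
    (hG_fin : muDisk G Set.univ < ∞) (hG_dec : ExpDec G)
    {w : Circle → ℝ} (hw : Measurable w) (hw0 : ∀ x, 0 ≤ w x) (hw_int : Integrable w circleMeasure)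
    {t : ℝ≥0∞} (ht : t ≠ 0) (ht' : t ≠ ∞) {k : ℕ} (hk : k ≠ 0) :
    ((fun x : Circle => (x : ℂ)) '' residualSet w).indicator (fun z => (starRingEnd ℂ) z ^ k)
      ∈ approxSubmodule t (mu G w) := by
  have hk' : (0 : ℝ) < k := by exact_mod_cast Nat.pos_of_ne_zero hk
  obtain ⟨p, hlim, hM⟩ := exists_polynomial_seq hG_meas hG_fin hG_dec hw hw0 hw_int
    (mul_pos hk' (ENNReal.toReal_pos ht ht'))
  refine mem_approxSubmodule_of_tendsto ht ht' (P := fun n => p n ^ k)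
    (M := fun z => (⨆ n, ‖(p n).eval z‖ₑ) ^ (k : ℝ)) ?_ ?_ ?_
  · filter_upwards [hlim] with z hz
    have h1 := hz.pow k
    simp only [Polynomial.eval_pow]
    convert h1 using 2
    by_cases hzF : z ∈ (fun x : Circle => (x : ℂ)) '' residualSet w
    · rw [indicator_of_mem hzF, indicator_of_mem hzF]
    · rw [indicator_of_notMem hzF, indicator_of_notMem hzF, zero_pow hk]
  · refine Eventually.of_forall fun z n => ?_
    rw [Polynomial.eval_pow, enorm_pow, ENNReal.rpow_natCast]
    gcongr
    exact le_iSup (fun n => ‖(p n).eval z‖ₑ) n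
  · simp_rw [← ENNReal.rpow_mul]
    exact hM

theorem exists_indicator_eq_fourier
    {G : ℝ → ℝ} (hG_meas : Measurable (fun x : Set.Ioc (0 : ℝ) 1 => G x))
    (hG_fin : muDisk G Set.univ < ∞) (hG_dec : ExpDec G)
    {w : Circle → ℝ} (hw : Measurable w) (hw0 : ∀ x, 0 ≤ w x) (hw_int : Integrable w circleMeasure)
    {t : ℝ≥0∞} (ht : t ≠ 0) (ht' : t ≠ ∞) (n : ℤ) :
    ∃ τ : ℂ → ℂ, ((fun x : Circle => (x : ℂ)) '' residualSet w).indicator τ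
      ∈ approxSubmodule t (mu G w) ∧
      ∀ θ : AddCircle (2 * Real.pi), τ (θ.toCircle : ℂ) = fourier n θ := by
  rcases n with k | k
  · refine ⟨_, indicator_pow_mem hG_meas hG_fin hG_dec hw hw0 hw_int ht ht' k, fun θ => ?_⟩
    simp [fourier_apply, AddCircle.toCircle_nsmul]
  · refine ⟨_, indicator_conj_pow_mem hG_meas hG_fin hG_dec hw hw0 hw_int ht ht' k.succ_ne_zero,
      fun θ => ?_⟩
    rw [fourier_apply, AddCircle.toCircle_zsmul, zpow_negSucc, Circle.coe_inv_eq_conj, Circle.coe_pow,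
      map_pow]

theorem indicator_mem_of_continuous
    {G : ℝ → ℝ} (hG_meas : Measurable (fun x : Set.Ioc (0 : ℝ) 1 => G x))
    (hG_fin : muDisk G Set.univ < ∞) (hG_dec : ExpDec G)
    {w : Circle → ℝ} (hw : Measurable w) (hw0 : ∀ x, 0 ≤ w x) (hw_int : Integrable w circleMeasure)
    {t : ℝ≥0∞} (ht : t ≠ 0) (ht' : t ≠ ∞) {φ : ℂ → ℂ} (hφ : Continuous φ) :
    ((fun x : Circle => (x : ℂ)) '' residualSet w).indicator φ ∈ approxSubmodule t (mu G w) := by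
  have := isFiniteMeasure_mu hG_fin hw_int
  have hFm : MeasurableSet ((fun x : Circle => (x : ℂ)) '' residualSet w) :=
    measurableEmbedding_coe.measurableSet_image.2 (measurableSet_residualSet hw)
  set F' := (fun x : Circle => (x : ℂ)) '' residualSet w with hF'
  have : Fact (0 < 2 * Real.pi) := ⟨Real.two_pi_pos⟩
  refine mem_approxSubmodule_of_forall (hφ.aestronglyMeasurable.indicator hFm) fun ε hε => ?_
  -- a positive `κ` with `κ * μ(ℂ) ^ (1 / t) ≤ ε`
  obtain ⟨κ, hκ, hκε⟩ : ∃ κ : ℝ, 0 < κ ∧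
      (mu G w univ) ^ t.toReal⁻¹ * ENNReal.ofReal κ ≤ ε := by
    have htop : (mu G w univ) ^ t.toReal⁻¹ ≠ ∞ :=
      ENNReal.rpow_ne_top_of_nonneg (inv_nonneg.2 ENNReal.toReal_nonneg) (measure_ne_top _ _)
    obtain ⟨κ, hκ, h⟩ := ENNReal.exists_nnreal_pos_mul_lt htop hε
    refine ⟨κ, hκ, ?_⟩
    rw [mul_comm, ENNReal.ofReal_coe_nnreal]
    exact h.le
  let φ' : C(AddCircle (2 * Real.pi), ℂ) :=
    ⟨fun θ => φ (θ.toCircle : ℂ), by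
      have := AddCircle.continuous_toCircle (T := 2 * Real.pi)
      fun_prop⟩
  have hmem : φ' ∈ (Submodule.span ℂ (range (@fourier (2 * Real.pi)))).topologicalClosure := by
    rw [span_fourier_closure_eq_top]
    trivial
  obtain ⟨v, hv, hvφ⟩ := Metric.mem_closure_iff.1 hmem κ hκ
  obtain ⟨τ, hτ, hτv⟩ : ∃ τ : ℂ → ℂ, F'.indicator τ ∈ approxSubmodule t (mu G w) ∧
      ∀ θ : AddCircle (2 * Real.pi), τ (θ.toCircle : ℂ) = v θ := by
    refine Submodule.span_induction ?_ ?_ ?_ ?_ hv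
    · rintro _ ⟨n, rfl⟩
      exact exists_indicator_eq_fourier hG_meas hG_fin hG_dec hw hw0 hw_int ht ht' n
    · exact ⟨0, by simp, fun θ => rfl⟩
    · rintro u₁ u₂ - - ⟨τ₁, h₁, h₁'⟩ ⟨τ₂, h₂, h₂'⟩
      refine ⟨τ₁ + τ₂, ?_, fun θ => by simp [h₁', h₂']⟩
      rw [indicator_add']
      exact add_mem h₁ h₂
    · rintro c u - ⟨τ₁, h₁, h₁'⟩
      refine ⟨c • τ₁, ?_, fun θ => by simp [h₁']⟩
      have h : F'.indicator (c • τ₁) = c • F'.indicator τ₁ := indicator_const_smul F' c τ₁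
      rw [h]
      exact Submodule.smul_mem _ c h₁
  refine ⟨_, hτ, ?_⟩
  refine (eLpNorm_le_of_ae_bound (C := κ) (Eventually.of_forall fun z => ?_)).trans hκε
  rw [← indicator_sub']
  by_cases hz : z ∈ F'
  · rw [indicator_of_mem hz]
    obtain ⟨x, -, rfl⟩ := hz
    obtain ⟨θ, rfl⟩ : ∃ θ : AddCircle (2 * Real.pi), θ.toCircle = x :=
      ⟨((Complex.arg x : ℝ) : AddCircle (2 * Real.pi)), by
        rw [AddCircle.toCircle_apply_mk, div_self Real.two_pi_pos.ne', one_mul, Circle.exp_arg]⟩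
    have h1 := ContinuousMap.dist_apply_le_dist (f := φ') (g := v) θ
    rw [Pi.sub_apply, hτv, ← dist_eq_norm]
    exact h1.trans hvφ.le
  · rw [indicator_of_notMem hz, norm_zero]
    exact hκ.le

end RadialSplitting

theorem mainTheorem3
    (G : ℝ → ℝ)
    (hG_nonneg : ∀ x ∈ Set.Ioc (0 : ℝ) 1, 0 ≤ G x)
    (hG_meas : Measurable (fun x : Set.Ioc (0 : ℝ) 1 => G x))
    (hG_fin : RadialSplitting.muDisk G Set.univ < ∞)
    (hG_dec : RadialSplitting.ExpDec G)
    (w : Circle → ℝ)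
    (hw_meas : Measurable w)
    (hw_nonneg : ∀ x, 0 ≤ w x)
    (hw_int : MeasureTheory.Integrable w RadialSplitting.circleMeasure)
    (hF : 0 < RadialSplitting.circleMeasure (RadialSplitting.residualSet w))
    (t : ℝ≥0∞) (ht_pos : 0 < t) (ht_fin : t < ∞) :
    RadialSplitting.LpRestrict t (RadialSplitting.mu G w)
        ((fun x : Circle => (x : ℂ)) '' RadialSplitting.residualSet w) ⊆
      RadialSplitting.polyClosure t (RadialSplitting.mu G w) := by
  open RadialSplitting in
  rintro f ⟨g, hfg⟩
  have := isFiniteMeasure_mu hG_fin hw_int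
  have hFm : MeasurableSet ((fun x : Circle => (x : ℂ)) '' residualSet w) :=
    measurableEmbedding_coe.measurableSet_image.2 (measurableSet_residualSet hw_meas)
  have hmem : (f : ℂ → ℂ) ∈ approxSubmodule t (mu G w) := by
    refine mem_approxSubmodule_of_forall (Lp.aestronglyMeasurable f) fun ε hε => ?_
    obtain ⟨φ, hφ, -⟩ := (Lp.memLp g).exists_boundedContinuous_eLpNorm_sub_le ht_fin.ne hε
    refine ⟨_, indicator_mem_of_continuous hG_meas hG_fin hG_dec hw_meas hw_nonneg hw_int ht_pos.ne'
      ht_fin.ne φ.continuous, ?_⟩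
    rw [← eLpNorm_indicator_eq_eLpNorm_restrict hFm] at hφ
    refine le_trans (le_of_eq (eLpNorm_congr_ae ?_)) hφ
    filter_upwards [hfg] with z hz
    rw [indicator_sub', Pi.sub_apply, Pi.sub_apply, hz]
  exact hmem.2
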